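/- Rings are associative with identity and modules are left modules. For a ring $R$ and an $R$-module $C$, let ${\rm Add}_R(C)$ (resp. ${\rm add}_R(C)$) be the class of all $R$-modules isomorphic to direct summands of direct sums (resp. finite direct sums) of copies of $C$. The module $C$ is $\Sigma$-self-orthogonal if ${\rm Ext}^i_R(C,C^{(I)})=0$ for every set $I$ and every $i\ge 1$. An exact sequence $\mathbf X$ is ${\rm Hom}_R(-,{\rm Add}_R(C))$-exact if ${\rm Hom}_R(\mathbf X,F)$ is exact for every $F\in{\rm Add}_R(C)$. An $R$-module $M$ is $G_C$-projective if there is a ${\rm Hom}_R(-,{\rm Add}_R(C))$-exact exact sequence $\cdots\to P_1\to P_0\to C^0\to C^1\to\cdots$ with all $P_i$ projective, all $C^i\in{\rm Add}_R(C)$ and $M\cong{\rm Im}(P_0\to C^0)$. The ring $R$ is CM-free relative to $C$ if the class of finitely generated $G_C$-projective $R$-modules equals ${\rm add}_R(C)$, and strongly CM-free relative to $C$ if the class of all $G_C$-projective $R$-modules equals ${\rm Add}_R(C)$. Let $A$ and $B$ be rings, $U$ a $(B,A)$-bimodule and $T=\begin{pmatrix}A&0\\U&B\end{pmatrix}$ the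 triangular matrix ring. Let $C_1$ be an $A$-module and $C_2$ a $B$-module, and let $C=\mathbf p(C_1,C_2)=\begin{pmatrix}C_1\\(U\otimes_AC_1)\oplus C_2\end{pmatrix}$ be the $T$-module of column vectors on which $T$ acts by $\begin{pmatrix}a&0\\u&b\end{pmatrix}\begin{pmatrix}x\\(y,z)\end{pmatrix}=\begin{pmatrix}ax\\(u\otimes x+by,\;bz)\end{pmatrix}$. Consider the following conditions. (a) $U\otimes_A\mathbf X_1$ is exact for every exact sequence of $A$-modules $\mathbf X_1:\cdots\to P^1_1\to P^0_1\to C^0_1\to C^1_1\to\cdots$ with all $P_1^i$ projective and all $C_1^i\in{\rm Add}_A(C_1)$. (a') $U\otimes_A\mathbf X_1$ is exact for every such $\mathbf X_1$ which is moreover ${\rm Hom}_A(-,{\rm Add}_A(C_1))$-exact. (b) ${\rm Hom}_B(\mathbf X_2,U\otimes_AY)$ is exact for every $Y\in{\rm Add}_A(C_1)$ and every ${\rm Hom}_B(-,{\rm Add}_B(C_2))$-exact exact sequence of $B$-modules $\mathbf X_2:\cdots\to P^1_2\to P^0_2\to C^0_2\to C^1_2\to\cdots$ with all $P_2^i$ projective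 and all $C_2^i\in{\rm Add}_B(C_2)$. The bimodule $U$ is $C$-compatible if (a) and (b) hold, and weakly $C$-compatible if (a') and (b) hold. **Proposition.** Assume that $C_1$ and $C_2$ are $\Sigma$-self-orthogonal and that $U$ is weakly $C$-compatible. 1. If $T$ is CM-free relative to $C$, then $A$ is CM-free relative to $C_1$ and $B$ is CM-free relative to $C_2$. If $T$ is strongly CM-free relative to $C$, then $A$ is strongly CM-free relative to $C_1$ and $B$ is strongly CM-free relative to $C_2$. 2. If moreover $U$ is $C$-compatible, then the converses hold too: $T$ is CM-free relative to $C$ if and only if $A$ and $B$ are CM-free relative to $C_1$ and $C_2$, respectively; and $T$ is strongly CM-free relative to $C$ if and only if $A$ and $B$ are strongly CM-free relative to $C_1$ and $C_2$, respectively. -/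

import Mathlib

universe u

open scoped TensorProduct

set_option linter.unusedSectionVars false

namespace RelGor

/-! ### The balanced tensor product `U ⊗_A M` of a `(B, A)`-bimodule and a left `A`-module

A `(B, A)`-bimodule is an abelian group `U` with `[Module B U] [Module Aᵐᵒᵖ U]` and
`[SMulCommClass B Aᵐᵒᵖ U]`; the right action `u · a` is `MulOpposite.op a • u`. -/

section Tensor

variable (A B U M : Type u) [Ring A] [Ring B] [AddCommGroup U] [Module B U] [Module Aᵐᵒᵖ U]
  [SMulCommClass B Aᵐᵒᵖ U] [AddCommGroup M] [Module A M]

/-- The relations `(u · a) ⊗ m - u ⊗ (a • m)` in `U ⊗_ℤ M`. -/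
def balRel : Set (U ⊗[ℤ] M) :=
  {x | ∃ (v : U) (a : A) (m : M), x = (MulOpposite.op a • v) ⊗ₜ[ℤ] m - v ⊗ₜ[ℤ] (a • m)}

/-- The subgroup of `U ⊗_ℤ M` generated by the relations; it is a `B`-submodule
(see `balSubmodule_toAddSubgroup`). -/
def balSubmodule : Submodule B (U ⊗[ℤ] M) := Submodule.span B (balRel A U M)

/-- The `B`-span of the relations is the additive subgroup they generate. -/
theorem balSubmodule_toAddSubgroup :
    (balSubmodule A B U M).toAddSubgroup = AddSubgroup.closure (balRel A U M) := by
  apply le_antisymm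
  · intro x hx
    have hx' : x ∈ Submodule.span B (balRel A U M) := hx
    clear hx
    induction hx' using Submodule.span_induction with
    | mem x hx => exact AddSubgroup.subset_closure hx
    | zero => exact zero_mem _
    | add x y _ _ h1 h2 => exact add_mem h1 h2
    | smul b x _ h =>
      refine AddSubgroup.closure_induction (p := fun y _ =>
        b • y ∈ AddSubgroup.closure (balRel A U M)) ?_ ?_ ?_ ?_ h
      · rintro _ ⟨v, a, m, rfl⟩
        refine AddSubgroup.subset_closure ⟨b • v, a, m, ?_⟩
        rw [smul_sub, TensorProduct.smul_tmul', TensorProduct.smul_tmul', smul_comm]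
      · rw [smul_zero]; exact zero_mem _
      · intro y z _ _ hy hz
        rw [smul_add]; exact add_mem hy hz
      · intro y _ hy
        rw [smul_neg]; exact neg_mem hy
  · rw [AddSubgroup.closure_le]
    exact fun x hx => Submodule.subset_span hx

/-- The left `B`-module `U ⊗_A M`. -/
abbrev BTensor : Type u := (U ⊗[ℤ] M) ⧸ balSubmodule A B U M

variable {U M}

/-- The class of `v ⊗ m` in `U ⊗_A M`. -/
def btmul (v : U) (m : M) : BTensor A B U M := (balSubmodule A B U M).mkQ (v ⊗ₜ[ℤ] m)

variable {A B}

theorem btmul_add (v : U) (m m' : M) :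
    btmul A B v (m + m') = btmul A B v m + btmul A B v m' := by
  simp only [btmul, TensorProduct.tmul_add, map_add]

theorem add_btmul (v v' : U) (m : M) :
    btmul A B (v + v') m = btmul A B v m + btmul A B v' m := by
  simp only [btmul, TensorProduct.add_tmul, map_add]

theorem btmul_zero (v : U) : btmul A B v (0 : M) = 0 := by
  simp only [btmul, TensorProduct.tmul_zero, map_zero]

theorem zero_btmul (m : M) : btmul A B (0 : U) m = 0 := by
  simp only [btmul, TensorProduct.zero_tmul, map_zero]

theorem smul_btmul (b : B) (v : U) (m : M) :
    b • btmul A B v m = btmul A B (b • v) m := by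
  simp only [btmul, ← map_smul, TensorProduct.smul_tmul']

theorem op_smul_btmul (a : A) (v : U) (m : M) :
    btmul A B (MulOpposite.op a • v) m = btmul A B v (a • m) := by
  have h : (MulOpposite.op a • v) ⊗ₜ[ℤ] m - v ⊗ₜ[ℤ] (a • m) ∈ balSubmodule A B U M :=
    Submodule.subset_span ⟨v, a, m, rfl⟩
  exact (Submodule.Quotient.eq _).2 h

variable (B U) {N : Type u} [AddCommGroup N] [Module A N]

/-- The map `1_U ⊗ f : U ⊗_A M → U ⊗_A N` induced by an `A`-linear map `f : M → N`. -/
def bmap (f : M →ₗ[A] N) : BTensor A B U M →ₗ[B] BTensor A B U N :=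
  (balSubmodule A B U M).mapQ (balSubmodule A B U N)
    (TensorProduct.AlgebraTensorModule.map (LinearMap.id : U →ₗ[B] U)
      f.toAddMonoidHom.toIntLinearMap) (by
      rw [balSubmodule, Submodule.span_le]
      rintro _ ⟨v, a, m, rfl⟩
      refine Submodule.subset_span ⟨v, a, f m, ?_⟩
      simp)

theorem bmap_btmul (f : M →ₗ[A] N) (v : U) (m : M) :
    bmap B U f (btmul A B v m) = btmul A B v (f m) := rfl

end Tensor

/-! ### The triangular matrix ring and its modules -/

/-- The formal triangular matrix ring `T = (A 0; U B)`: matrices with diagonal entries `a`, `b`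
and lower left entry `u`. -/
@[ext]
structure TriRing (A B U : Type u) : Type u where
  a : A
  u : U
  b : B

namespace TriRing

variable {A B U : Type u} [Ring A] [Ring B] [AddCommGroup U] [Module B U] [Module Aᵐᵒᵖ U]

instance : Zero (TriRing A B U) := ⟨⟨0, 0, 0⟩⟩
instance : One (TriRing A B U) := ⟨⟨1, 0, 1⟩⟩
instance : Add (TriRing A B U) := ⟨fun s t => ⟨s.a + t.a, s.u + t.u, s.b + t.b⟩⟩
instance : Neg (TriRing A B U) := ⟨fun s => ⟨-s.a, -s.u, -s.b⟩⟩

/-- Matrix multiplication. -/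
instance : Mul (TriRing A B U) :=
  ⟨fun s t => ⟨s.a * t.a, MulOpposite.op t.a • s.u + s.b • t.u, s.b * t.b⟩⟩

@[simp] theorem zero_a : (0 : TriRing A B U).a = 0 := rfl
@[simp] theorem zero_u : (0 : TriRing A B U).u = 0 := rfl
@[simp] theorem zero_b : (0 : TriRing A B U).b = 0 := rfl
@[simp] theorem one_a : (1 : TriRing A B U).a = 1 := rfl
@[simp] theorem one_u : (1 : TriRing A B U).u = 0 := rfl
@[simp] theorem one_b : (1 : TriRing A B U).b = 1 := rfl
@[simp] theorem add_a (s t : TriRing A B U) : (s + t).a = s.a + t.a := rfl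
@[simp] theorem add_u (s t : TriRing A B U) : (s + t).u = s.u + t.u := rfl
@[simp] theorem add_b (s t : TriRing A B U) : (s + t).b = s.b + t.b := rfl
@[simp] theorem neg_a (s : TriRing A B U) : (-s).a = -s.a := rfl
@[simp] theorem neg_u (s : TriRing A B U) : (-s).u = -s.u := rfl
@[simp] theorem neg_b (s : TriRing A B U) : (-s).b = -s.b := rfl
@[simp] theorem mul_a (s t : TriRing A B U) : (s * t).a = s.a * t.a := rfl
@[simp] theorem mul_u (s t : TriRing A B U) :
    (s * t).u = MulOpposite.op t.a • s.u + s.b • t.u := rfl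
@[simp] theorem mul_b (s t : TriRing A B U) : (s * t).b = s.b * t.b := rfl

instance instRing [SMulCommClass B Aᵐᵒᵖ U] : Ring (TriRing A B U) where
  add_assoc s t r := by ext <;> simp [add_assoc]
  zero_add s := by ext <;> simp
  add_zero s := by ext <;> simp
  add_comm s t := by ext <;> simp [add_comm]
  neg_add_cancel s := by ext <;> simp
  nsmul := nsmulRec
  zsmul := zsmulRec
  mul_assoc s t r := by
    ext <;> simp [mul_assoc, mul_smul, smul_add, add_assoc, smul_comm s.b (MulOpposite.op r.a)]
  one_mul s := by ext <;> simp
  mul_one s := by ext <;> simp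
  left_distrib s t r := by
    ext
    · simp [mul_add]
    · simp only [mul_u, add_a, add_u, MulOpposite.op_add, add_smul, smul_add]; abel
    · simp [mul_add]
  right_distrib s t r := by
    ext
    · simp [add_mul]
    · simp only [mul_u, add_b, add_u, add_smul, smul_add]; abel
    · simp [add_mul]
  zero_mul s := by ext <;> simp
  mul_zero s := by ext <;> simp

end TriRing

section TriMod

variable {A B U M₁ M₂ : Type u} [Ring A] [Ring B] [AddCommGroup U] [Module B U] [Module Aᵐᵒᵖ U]
  [SMulCommClass B Aᵐᵒᵖ U] [AddCommGroup M₁] [Module A M₁] [AddCommGroup M₂] [Module B M₂]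

/-- The left `T`-module `(M₁; M₂)_φ` of column vectors given by an `A`-module `M₁`, a `B`-module
`M₂` and a `B`-linear map `φ : U ⊗_A M₁ → M₂`. -/
@[ext]
structure TriMod (φ : BTensor A B U M₁ →ₗ[B] M₂) : Type u where
  fst : M₁
  snd : M₂

namespace TriMod

variable {φ : BTensor A B U M₁ →ₗ[B] M₂}

instance : Zero (TriMod φ) := ⟨⟨0, 0⟩⟩
instance : Add (TriMod φ) := ⟨fun x y => ⟨x.fst + y.fst, x.snd + y.snd⟩⟩
instance : Neg (TriMod φ) := ⟨fun x => ⟨-x.fst, -x.snd⟩⟩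

/-- `(a 0; v b) • (x; y) = (a x; φ (v ⊗ x) + b y)`. -/
instance : SMul (TriRing A B U) (TriMod φ) :=
  ⟨fun t x => ⟨t.a • x.fst, φ (btmul A B t.u x.fst) + t.b • x.snd⟩⟩

@[simp] theorem zero_fst : (0 : TriMod φ).fst = 0 := rfl
@[simp] theorem zero_snd : (0 : TriMod φ).snd = 0 := rfl
@[simp] theorem add_fst (x y : TriMod φ) : (x + y).fst = x.fst + y.fst := rfl
@[simp] theorem add_snd (x y : TriMod φ) : (x + y).snd = x.snd + y.snd := rfl
@[simp] theorem neg_fst (x : TriMod φ) : (-x).fst = -x.fst := rfl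
@[simp] theorem neg_snd (x : TriMod φ) : (-x).snd = -x.snd := rfl
@[simp] theorem smul_fst (t : TriRing A B U) (x : TriMod φ) : (t • x).fst = t.a • x.fst := rfl
@[simp] theorem smul_snd (t : TriRing A B U) (x : TriMod φ) :
    (t • x).snd = φ (btmul A B t.u x.fst) + t.b • x.snd := rfl

instance : AddCommGroup (TriMod φ) where
  add_assoc x y z := by ext <;> simp [add_assoc]
  zero_add x := by ext <;> simp
  add_zero x := by ext <;> simp
  add_comm x y := by ext <;> simp [add_comm]
  neg_add_cancel x := by ext <;> simp
  nsmul := nsmulRec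
  zsmul := zsmulRec

instance : Module (TriRing A B U) (TriMod φ) where
  one_smul x := by ext <;> simp [zero_btmul]
  mul_smul s t x := by
    ext
    · simp [mul_smul]
    · simp [mul_smul, add_btmul, op_smul_btmul, ← smul_btmul, add_assoc]
  smul_zero t := by ext <;> simp [btmul_zero]
  smul_add t x y := by
    ext
    · simp
    · simp only [smul_snd, add_fst, add_snd, btmul_add, map_add, smul_add]; abel
  add_smul s t x := by
    ext
    · simp [add_smul]
    · simp only [smul_snd, add_snd, TriRing.add_u, TriRing.add_b, add_btmul, map_add, add_smul]
      abel
  zero_smul x := by ext <;> simp [zero_btmul]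

end TriMod

variable (A B U M₁ M₂)

/-- The `T`-module `p(M₁, M₂) = (M₁; (U ⊗_A M₁) ⊕ M₂)` with structure map the inclusion of the
first summand. -/
abbrev pMod : Type u := TriMod (LinearMap.inl B (BTensor A B U M₁) M₂)

end TriMod

/-! ### Relative Gorenstein projective modules -/

section Ring

variable (R : Type u) [Ring R]

/-- `X` is in `Add_R(C)`: it is isomorphic to a direct summand of a direct sum `C^(I)`. -/
def IsBigAdd (C : Type u) [AddCommGroup C] [Module R C]
    (X : Type u) [AddCommGroup X] [Module R X] : Prop :=
  ∃ (I : Type u) (Y : ModuleCat.{u} R), Nonempty ((X × Y) ≃ₗ[R] (I →₀ C))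

/-- `X` is in `add_R(C)`: it is isomorphic to a direct summand of a finite direct sum `C^n`. -/
def IsSmallAdd (C : Type u) [AddCommGroup C] [Module R C]
    (X : Type u) [AddCommGroup X] [Module R X] : Prop :=
  ∃ (n : ℕ) (Y : ModuleCat.{u} R), Nonempty ((X × Y) ≃ₗ[R] (Fin n → C))

/-- `C` is `Σ`-self-orthogonal: `Ext^i(C, C^(I)) = 0` for every set `I` and `i ≥ 1`. -/
def SigmaSelfOrthogonal (C : Type u) [AddCommGroup C] [Module R C] : Prop :=
  ∀ (I : Type u) (i : ℕ), 1 ≤ i →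
    Subsingleton (CategoryTheory.Abelian.Ext.{u}
      (ModuleCat.of R C) (ModuleCat.of R (I →₀ C)) i)

/-- A doubly infinite sequence `⋯ → X (-2) → X (-1) → X 0 → X 1 → ⋯` of `R`-modules. -/
structure ModSeq where
  X : ℤ → ModuleCat.{u} R
  d : ∀ n, X n →ₗ[R] X (n + 1)

namespace ModSeq

variable {R}

/-- Exactness at every term. -/
def IsExact (S : ModSeq R) : Prop :=
  ∀ n, Function.Exact (S.d n) (S.d (n + 1))

/-- The sequence `Hom_R(S, F)` is exact. -/
def HomExact (S : ModSeq R) (F : Type u) [AddCommGroup F] [Module R F] : Prop :=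
  ∀ n, Function.Exact
    (fun f : S.X (n + 1 + 1) →ₗ[R] F => f ∘ₗ S.d (n + 1))
    (fun f : S.X (n + 1) →ₗ[R] F => f ∘ₗ S.d n)

/-- The sequence is `Hom_R(-, Add_R(C))`-exact. -/
def HomAddExact (S : ModSeq R) (C : Type u) [AddCommGroup C] [Module R C] : Prop :=
  ∀ F : ModuleCat.{u} R, IsBigAdd R C F → S.HomExact F

/-- The shape `⋯ → P₁ → P₀ → C⁰ → C¹ → ⋯` with all `Pᵢ` projective and all `Cⁱ` in `Add_R(C)`:
`P₀, P₁, …` stand in degrees `-1, -2, …` and `C⁰, C¹, …` in degrees `0, 1, …`. -/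
def HasShape (S : ModSeq R) (C : Type u) [AddCommGroup C] [Module R C] : Prop :=
  (∀ n < 0, Module.Projective R (S.X n)) ∧ ∀ n, 0 ≤ n → IsBigAdd R C (S.X n)

/-- The sequence `U ⊗_A S` is exact, for `S` a sequence of `A`-modules. -/
def TensorExact {A : Type u} [Ring A] (S : ModSeq A) (B U : Type u) [Ring B] [AddCommGroup U]
    [Module B U] [Module Aᵐᵒᵖ U] [SMulCommClass B Aᵐᵒᵖ U] : Prop :=
  ∀ n, Function.Exact (bmap B U (S.d n)) (bmap B U (S.d (n + 1)))

end ModSeq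

/-- `M` is `G_C`-projective: `M ≅ Im(P₀ → C⁰)` for some `Hom_R(-, Add_R(C))`-exact exact sequence
`⋯ → P₁ → P₀ → C⁰ → C¹ → ⋯` with all `Pᵢ` projective and all `Cⁱ` in `Add_R(C)`. -/
def IsGProjective (C : Type u) [AddCommGroup C] [Module R C]
    (M : Type u) [AddCommGroup M] [Module R M] : Prop :=
  ∃ S : ModSeq R, S.IsExact ∧ S.HomAddExact C ∧ S.HasShape C ∧
    Nonempty (M ≃ₗ[R] LinearMap.range (S.d (-1)))

/-- `R` is CM-free relative to `C`: the finitely generated `G_C`-projective modules are exactly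
the modules in `add_R(C)`. -/
def IsCMFree (C : Type u) [AddCommGroup C] [Module R C] : Prop :=
  ∀ M : ModuleCat.{u} R, (IsGProjective R C M ∧ Module.Finite R M) ↔ IsSmallAdd R C M

/-- `R` is strongly CM-free relative to `C`: the `G_C`-projective modules are exactly the modules
in `Add_R(C)`. -/
def IsStronglyCMFree (C : Type u) [AddCommGroup C] [Module R C] : Prop :=
  ∀ M : ModuleCat.{u} R, IsGProjective R C M ↔ IsBigAdd R C M

end Ring

/-! ### Compatible bimodules -/

section Compatible

variable (A B U C₁ C₂ : Type u) [Ring A] [Ring B] [AddCommGroup U] [Module B U] [Module Aᵐᵒᵖ U]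
  [SMulCommClass B Aᵐᵒᵖ U] [AddCommGroup C₁] [Module A C₁] [AddCommGroup C₂] [Module B C₂]

/-- Condition (a): `U ⊗_A -` keeps exact every exact sequence
`⋯ → P₁ → P₀ → C⁰ → C¹ → ⋯` with `Pᵢ` projective and `Cⁱ` in `Add_A(C₁)`. -/
def CompatA : Prop :=
  ∀ S : ModSeq A, S.IsExact → S.HasShape C₁ → S.TensorExact B U

/-- Condition (a'): the same for those sequences that are `Hom_A(-, Add_A(C₁))`-exact. -/
def CompatA' : Prop :=
  ∀ S : ModSeq A, S.IsExact → S.HomAddExact C₁ → S.HasShape C₁ → S.TensorExact B U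

/-- Condition (b): `Hom_B(-, U ⊗_A Y)`, for `Y` in `Add_A(C₁)`, keeps exact every
`Hom_B(-, Add_B(C₂))`-exact exact sequence `⋯ → P₁ → P₀ → C⁰ → C¹ → ⋯` with `Pᵢ` projective and
`Cⁱ` in `Add_B(C₂)`. -/
def CompatB : Prop :=
  ∀ S : ModSeq B, S.IsExact → S.HomAddExact C₂ → S.HasShape C₂ →
    ∀ Y : ModuleCat.{u} A, IsBigAdd A C₁ Y → S.HomExact (BTensor A B U Y)

/-- The bimodule `U` is `p(C₁, C₂)`-compatible. -/
def IsCompatible : Prop := CompatA A B U C₁ ∧ CompatB A B U C₁ C₂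

/-- The bimodule `U` is weakly `p(C₁, C₂)`-compatible. -/
def IsWeaklyCompatible : Prop := CompatA' A B U C₁ ∧ CompatB A B U C₁ C₂

end Compatible

end RelGor

/-! A `T`-module `N` amounts to `Fst N`, `Snd N` and a structure map `phi : U ⊗ Fst N → Snd N`;
write `Bar N` for the cokernel of `phi`. The functor `p` is left adjoint to `N ↦ (Fst N, Snd N)`,
and `N ≅ p(Fst N, Bar N)` exactly when `phi` is a split monomorphism. This holds for projective
modules and for modules in `Add(C)`, whose components are then projective, resp. in `Add(C₁)` and
`Add(C₂)`. The proposition follows once relative Gorenstein projectivity is compared across this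
correspondence.

From components to `T` (`isGProjective_pMod`): apply `p` termwise to sequences for `M₁` and `M₂`.
Condition (a') gives exactness. By adjunction, Hom into `F` in `Add(C)` splits into Hom into `Fst
F`, which lies in `Add(C₁)`, and into `Snd F`, a retract of `(U ⊗ C₁^(I)) × C₂^(I)`; (b) handles the
tensor factor.

From `T` to components (`IsGProjective.components`): the first components of a sequence for `N` are
exact, so (a) makes their tensor product with `U` exact, hence the cokernel sequence is exact.
Testing against `p(0, F)` gives Hom-exactness of the cokernels; (b) and testing against `p(Y, 0)`
then give it for the first components. If moreover `Fst N` is in `Add(C₁)`, Hom-exactness splits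
`Fst N → Fst C⁰`, so `phi` splits and `N ≅ p(Fst N, Bar N)`.

Self-orthogonality makes modules in `Add` Gorenstein projective
(`SigmaSelfOrthogonal.isGProjective`): a free resolution of `X`, continued by `X → 0`, is Hom-exact
because `Ext` vanishes. For part 1, `M` is tested through `p(M, 0)` or `p(0, M)`. -/

namespace RelGor

open CategoryTheory

/-! ### Vanishing of `Ext`: dimension shifting and direct sums in the first variable. -/

section ExtVanishing

variable {R : Type u} [Ring R]

/-- The vanishing of `Ext^n_R(M, F)`. -/
abbrev ExtVanishes (R : Type u) [Ring R] (M F : Type u) [AddCommGroup M] [Module R M]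
    [AddCommGroup F] [Module R F] (n : ℕ) : Prop :=
  Subsingleton (Abelian.Ext.{u} (ModuleCat.of R M) (ModuleCat.of R F) n)

variable {K P M F : Type u} [AddCommGroup K] [Module R K] [AddCommGroup P] [Module R P]
  [AddCommGroup M] [Module R M] [AddCommGroup F] [Module R F]

theorem shortExact_of_exact {i : K →ₗ[R] P} {p : P →ₗ[R] M} (hi : Function.Injective i)
    (hip : Function.Exact i p) (hp : Function.Surjective p) :
    (ModuleCat.shortComplexOfCompEqZero i p hip.linearMap_comp_eq_zero).ShortExact :=
  ModuleCat.shortComplex_shortExact _ hip hi hp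

/-- The obstruction to extending `f` along `i` is its image under the connecting map `Hom(K, F) →
Ext¹(M, F)`. -/
theorem exists_extend_of_extVanishes {i : K →ₗ[R] P} {p : P →ₗ[R] M}
    (hi : Function.Injective i) (hip : Function.Exact i p) (hp : Function.Surjective p)
    (h : ExtVanishes R M F 1) (f : K →ₗ[R] F) : ∃ g : P →ₗ[R] F, g ∘ₗ i = f := by
  obtain ⟨x, hx⟩ := Abelian.Ext.contravariant_sequence_exact₁ (shortExact_of_exact hi hip hp)
    (ModuleCat.of R F) (Abelian.Ext.mk₀ (ModuleCat.ofHom f)) (n₁ := 1) rfl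
    (Subsingleton.elim (h := h) _ _)
  obtain ⟨g, rfl⟩ := (Abelian.Ext.mk₀_bijective _ _).2 x
  rw [Abelian.Ext.mk₀_comp_mk₀] at hx
  have := (Abelian.Ext.mk₀_bijective _ _).1 hx
  exact ⟨g.hom, congrArg ModuleCat.Hom.hom this⟩

/-- As `Ext¹(P, F) = 0`, every class in `Ext¹(M, F)` comes from some `f : K → F`, and it dies if `f`
extends to `P`. -/
theorem extVanishes_one_of_extend [Module.Projective R P] {i : K →ₗ[R] P} {p : P →ₗ[R] M}
    (hi : Function.Injective i) (hip : Function.Exact i p) (hp : Function.Surjective p)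
    (h : ∀ f : K →ₗ[R] F, ∃ g : P →ₗ[R] F, g ∘ₗ i = f) : ExtVanishes R M F 1 := by
  refine subsingleton_of_forall_eq 0 fun x => ?_
  have hS := shortExact_of_exact hi hip hp
  have : Projective (ModuleCat.of R P) := (IsProjective.iff_projective P).1 inferInstance
  obtain ⟨y, rfl⟩ := Abelian.Ext.contravariant_sequence_exact₃ hS (ModuleCat.of R F) x
    (Abelian.Ext.eq_zero_of_projective _) (n₀ := 0) rfl
  obtain ⟨f, rfl⟩ := (Abelian.Ext.mk₀_bijective _ _).2 y
  obtain ⟨g, hg⟩ := h f.hom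
  have : f = ModuleCat.ofHom i ≫ ModuleCat.ofHom g := by
    ext x; exact (LinearMap.congr_fun hg x).symm
  rw [this, ← Abelian.Ext.mk₀_comp_mk₀]
  exact hS.extClass_comp_assoc _

/-- Dimension shifting; the degree on `K` must be positive so that the `Ext` group of `P` vanishes
there. -/
theorem extVanishes_kernel [Module.Projective R P] {i : K →ₗ[R] P} {p : P →ₗ[R] M}
    (hi : Function.Injective i) (hip : Function.Exact i p) (hp : Function.Surjective p) {n : ℕ}
    (h : ExtVanishes R M F (n + 1 + 1)) : ExtVanishes R K F (n + 1) := by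
  refine subsingleton_of_forall_eq 0 fun x => ?_
  have hS := shortExact_of_exact hi hip hp
  have : Projective (ModuleCat.of R P) := (IsProjective.iff_projective P).1 inferInstance
  obtain ⟨y, rfl⟩ := Abelian.Ext.contravariant_sequence_exact₁ hS (ModuleCat.of R F) x
    (n₁ := n + 1 + 1) (by omega) (Subsingleton.elim (h := h) _ _)
  rw [Abelian.Ext.eq_zero_of_projective y, Abelian.Ext.comp_zero]

theorem extVanishes_of_kernel [Module.Projective R P] {i : K →ₗ[R] P} {p : P →ₗ[R] M}
    (hi : Function.Injective i) (hip : Function.Exact i p) (hp : Function.Surjective p) {n : ℕ}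
    (h : ExtVanishes R K F n) : ExtVanishes R M F (n + 1) := by
  refine subsingleton_of_forall_eq 0 fun x => ?_
  have hS := shortExact_of_exact hi hip hp
  have : Projective (ModuleCat.of R P) := (IsProjective.iff_projective P).1 inferInstance
  obtain ⟨y, rfl⟩ := Abelian.Ext.contravariant_sequence_exact₃ hS (ModuleCat.of R F) x
    (Abelian.Ext.eq_zero_of_projective _) (n₀ := n) (by omega)
  rw [Subsingleton.elim (h := h) y 0, Abelian.Ext.comp_zero]

theorem extVanishes_retract {i : M →ₗ[R] P} {r : P →ₗ[R] M} (hri : r ∘ₗ i = LinearMap.id) {n : ℕ}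
    (h : ExtVanishes R P F n) : ExtVanishes R M F n := by
  refine subsingleton_of_forall_eq 0 fun x => ?_
  have h1 : ModuleCat.ofHom i ≫ ModuleCat.ofHom r = 𝟙 (ModuleCat.of R M) := by
    rw [← ModuleCat.ofHom_comp, hri]; rfl
  rw [← Abelian.Ext.mk₀_id_comp x, ← h1, ← Abelian.Ext.mk₀_comp_mk₀_assoc,
    Subsingleton.elim (h := h) ((Abelian.Ext.mk₀ (ModuleCat.ofHom r)).comp x (zero_add n)) 0,
    Abelian.Ext.comp_zero]

theorem finsupp_mapRange_exact {i : K →ₗ[R] P} {p : P →ₗ[R] M} (hi : Function.Injective i)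
    (hip : Function.Exact i p) (J : Type*) :
    Function.Exact (Finsupp.mapRange.linearMap (α := J) i) (Finsupp.mapRange.linearMap p) := by
  rw [LinearMap.exact_iff, Finsupp.ker_mapRange,
    Finsupp.range_mapRange_linearMap _ (LinearMap.ker_eq_bot.2 hi), hip.linearMap_ker_eq]

theorem finsupp_mapRange_injective {i : K →ₗ[R] P} (hi : Function.Injective i) (J : Type*) :
    Function.Injective (Finsupp.mapRange.linearMap (α := J) i) :=
  Finsupp.mapRange_injective _ (map_zero _) hi

theorem finsupp_mapRange_surjective {p : P →ₗ[R] M} (hp : Function.Surjective p) (J : Type*) :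
    Function.Surjective (Finsupp.mapRange.linearMap (α := J) p) :=
  Finsupp.mapRange_surjective _ (map_zero _) hp

theorem exists_free_cover (M : Type u) [AddCommGroup M] [Module R M] :
    ∃ (K P : ModuleCat.{u} R) (_ : Module.Free R P) (i : K →ₗ[R] P) (p : P →ₗ[R] M),
      Function.Injective i ∧ Function.Exact i p ∧ Function.Surjective p := by
  let p : (M →₀ R) →ₗ[R] M := Finsupp.linearCombination R id
  refine ⟨ModuleCat.of R (LinearMap.ker p), ModuleCat.of R (M →₀ R),
    inferInstanceAs (Module.Free R (M →₀ R)), (LinearMap.ker p).subtype, p,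
    (LinearMap.ker p).injective_subtype, p.exact_subtype_ker_map, fun x => ?_⟩
  exact ⟨Finsupp.single x (1 : R), by simp [p]⟩

/-- Sums of free covers are free covers, so dimension shifting reduces to degree 1, where maps out
of the sum are extended summand by summand. `M` is quantified inside the induction because the step
passes to a syzygy. -/
theorem extVanishes_finsupp (J : Type u) (n : ℕ) : ∀ (M : Type u) [AddCommGroup M] [Module R M],
    ExtVanishes R M F (n + 1) → ExtVanishes R (J →₀ M) F (n + 1) := by
  induction n with
  | zero =>
    intro M _ _ h
    obtain ⟨K, P, _, i, p, hi, hip, hp⟩ := exists_free_cover (R := R) M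
    have : Module.Projective R (J →₀ P) := .of_free
    refine extVanishes_one_of_extend (finsupp_mapRange_injective hi J)
      (finsupp_mapRange_exact hi hip J) (finsupp_mapRange_surjective hp J) fun f => ?_
    choose g hg using fun j => exists_extend_of_extVanishes hi hip hp h (f ∘ₗ Finsupp.lsingle j)
    -- The scalars `ℕ` only serve the module structure on Hom groups, since `R` need not be
    -- commutative.
    refine ⟨Finsupp.lsum ℕ g, ?_⟩
    ext j x
    simpa using LinearMap.congr_fun (hg j) x
  | succ n ih =>
    intro M _ _ h
    obtain ⟨K, P, _, i, p, hi, hip, hp⟩ := exists_free_cover (R := R) M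
    have : Module.Projective R P := .of_free
    have : Module.Projective R (J →₀ P) := .of_free
    have h2 := ih _ (extVanishes_kernel hi hip hp h)
    exact extVanishes_of_kernel (finsupp_mapRange_injective hi J)
      (finsupp_mapRange_exact hi hip J) (finsupp_mapRange_surjective hp J) h2

end ExtVanishing

/-! ### Retracts and the classes `Add` and `add`. -/

section AddClass

variable (R : Type u) [Ring R]

/-- `X` is a retract of `Z`. -/
def IsRetract (X : Type*) [AddCommGroup X] [Module R X] (Z : Type*) [AddCommGroup Z]
    [Module R Z] : Prop :=
  ∃ (i : X →ₗ[R] Z) (r : Z →ₗ[R] X), r ∘ₗ i = LinearMap.id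

variable {R}
variable {X Y Z : Type*} [AddCommGroup X] [Module R X] [AddCommGroup Y] [Module R Y]
  [AddCommGroup Z] [Module R Z]

theorem IsRetract.trans (h : IsRetract R X Y) (h' : IsRetract R Y Z) : IsRetract R X Z := by
  obtain ⟨i, r, h⟩ := h
  obtain ⟨j, s, h'⟩ := h'
  refine ⟨j ∘ₗ i, r ∘ₗ s, LinearMap.ext fun x => ?_⟩
  have h1 := LinearMap.congr_fun h' (i x)
  have h2 := LinearMap.congr_fun h x
  simp only [LinearMap.comp_apply, LinearMap.id_apply] at h1 h2 ⊢
  rw [h1, h2]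

theorem IsRetract.of_equiv (e : X ≃ₗ[R] Y) : IsRetract R X Y :=
  ⟨e.toLinearMap, e.symm.toLinearMap, by ext; simp⟩

theorem IsRetract.exists_prod_equiv {X Z : Type u} [AddCommGroup X] [Module R X] [AddCommGroup Z]
    [Module R Z] (h : IsRetract R X Z) :
    ∃ Y : ModuleCat.{u} R, Nonempty ((X × Y) ≃ₗ[R] Z) := by
  obtain ⟨i, r, h⟩ := h
  have hr : ∀ x, r (i x) = x := fun x => LinearMap.congr_fun h x
  refine ⟨ModuleCat.of R (LinearMap.ker r), ⟨LinearEquiv.ofLinearMap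
    (i.coprod (LinearMap.ker r).subtype)
    (r.prod ((LinearMap.id - i ∘ₗ r).codRestrict (LinearMap.ker r) fun z => by simp [hr]))
    ?_ ?_⟩⟩
  · ext z; simp
  · ext x
    · simp [hr]
    · simp [hr]
    · simp
    · simp

theorem isRetract_of_prod_equiv (e : (X × Y) ≃ₗ[R] Z) : IsRetract R X Z :=
  ⟨e.toLinearMap ∘ₗ LinearMap.inl R X Y, LinearMap.fst R X Y ∘ₗ e.symm.toLinearMap, by
    ext; simp⟩

/-- Extension by zero followed by restriction is the identity. This brings sums over different index
sets to a common one. -/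
theorem IsRetract.finsupp_index {I J : Type*} (f : I ↪ J) (X : Type*) [AddCommGroup X]
    [Module R X] : IsRetract R (I →₀ X) (J →₀ X) :=
  ⟨Finsupp.lmapDomain X R f, Finsupp.lcomapDomain f f.injective, by
    refine LinearMap.ext fun x => ?_
    ext i
    simp [Finsupp.lcomapDomain, Finsupp.mapDomain_apply f.injective]⟩

variable {C : Type u} [AddCommGroup C] [Module R C]

theorem isBigAdd_iff {X : Type u} [AddCommGroup X] [Module R X] :
    IsBigAdd R C X ↔ ∃ I : Type u, IsRetract R X (I →₀ C) :=
  ⟨fun ⟨I, _, ⟨e⟩⟩ => ⟨I, isRetract_of_prod_equiv e⟩, fun ⟨I, h⟩ => ⟨I, h.exists_prod_equiv⟩⟩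

/-- Lifting `Fin n` to the universe `u` puts `add` and `Add` in the same form, so that one argument
about retracts of `I →₀ C` serves both. -/
theorem isSmallAdd_iff {X : Type u} [AddCommGroup X] [Module R X] :
    IsSmallAdd R C X ↔ ∃ n : ℕ, IsRetract R X (ULift.{u} (Fin n) →₀ C) := by
  have e (n : ℕ) : (ULift.{u} (Fin n) →₀ C) ≃ₗ[R] (Fin n → C) :=
    (Finsupp.domLCongr Equiv.ulift).trans (Finsupp.linearEquivFunOnFinite R C (Fin n))
  constructor
  · rintro ⟨n, _, ⟨f⟩⟩
    exact ⟨n, isRetract_of_prod_equiv (f.trans (e n).symm)⟩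
  · rintro ⟨n, h⟩
    exact ⟨n, (h.trans (.of_equiv (e n))).exists_prod_equiv⟩

theorem IsSmallAdd.isBigAdd {X : Type u} [AddCommGroup X] [Module R X] (h : IsSmallAdd R C X) :
    IsBigAdd R C X :=
  let ⟨n, h⟩ := isSmallAdd_iff.1 h
  isBigAdd_iff.2 ⟨ULift (Fin n), h⟩

theorem IsBigAdd.retract {X Y : Type u} [AddCommGroup X] [Module R X] [AddCommGroup Y] [Module R Y]
    (h : IsRetract R X Y) (hY : IsBigAdd R C Y) : IsBigAdd R C X := by
  obtain ⟨I, hY⟩ := isBigAdd_iff.1 hY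
  exact isBigAdd_iff.2 ⟨I, h.trans hY⟩

theorem IsSmallAdd.retract {X Y : Type u} [AddCommGroup X] [Module R X] [AddCommGroup Y]
    [Module R Y] (h : IsRetract R X Y) (hY : IsSmallAdd R C Y) : IsSmallAdd R C X := by
  obtain ⟨I, hY⟩ := isSmallAdd_iff.1 hY
  exact isSmallAdd_iff.2 ⟨I, h.trans hY⟩

theorem isBigAdd_of_subsingleton (C : Type u) [AddCommGroup C] [Module R C]
    (X : Type u) [AddCommGroup X] [Module R X] [Subsingleton X] : IsBigAdd R C X :=
  isBigAdd_iff.2 ⟨PEmpty, 0, 0, LinearMap.ext fun _ => Subsingleton.elim _ _⟩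

theorem isSmallAdd_self : IsSmallAdd R C C :=
  isSmallAdd_iff.2 ⟨1, Finsupp.lsingle ⟨0⟩, Finsupp.lapply ⟨0⟩, by ext; simp⟩

end AddClass

/-! ### Hom-exact sequences, and Gorenstein projectivity of modules in `Add(C)`. -/

section Sequences

variable {R : Type u} [Ring R]

theorem ModSeq.HomExact.retract {S : ModSeq R} {F G : Type u} [AddCommGroup F] [Module R F]
    [AddCommGroup G] [Module R G] (h : IsRetract R F G) (hG : S.HomExact G) : S.HomExact F := by
  obtain ⟨i, r, hri⟩ := h
  intro n f
  constructor
  · intro hf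
    obtain ⟨g, hg⟩ := (hG n (i ∘ₗ f)).1 (by
      change i ∘ₗ f ∘ₗ S.d n = 0
      rw [show f ∘ₗ S.d n = 0 from hf, LinearMap.comp_zero])
    refine ⟨r ∘ₗ g, ?_⟩
    change r ∘ₗ g ∘ₗ S.d (n + 1) = f
    rw [show g ∘ₗ S.d (n + 1) = i ∘ₗ f from hg, ← LinearMap.comp_assoc, hri, LinearMap.id_comp]
  · rintro ⟨g, rfl⟩
    have := (hG n (i ∘ₗ g ∘ₗ S.d (n + 1))).2 ⟨i ∘ₗ g, rfl⟩
    have h2 : i ∘ₗ (g ∘ₗ S.d (n + 1)) ∘ₗ S.d n = 0 := this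
    change (g ∘ₗ S.d (n + 1)) ∘ₗ S.d n = 0
    rw [← LinearMap.id_comp (_ ∘ₗ S.d n), ← hri, LinearMap.comp_assoc, h2, LinearMap.comp_zero]

theorem ModSeq.IsExact.comp_eq_zero {S : ModSeq R} (h : S.IsExact) (n : ℤ) :
    S.d (n + 1) ∘ₗ S.d n = 0 := (h n).linearMap_comp_eq_zero

/-- For exact sequences, only one inclusion in the definition of `HomExact` has content. -/
theorem ModSeq.IsExact.homExact {S : ModSeq R} (h : S.IsExact) {F : Type u} [AddCommGroup F]
    [Module R F] (hF : ∀ (n : ℤ) (f : S.X (n + 1) →ₗ[R] F), f ∘ₗ S.d n = 0 →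
      ∃ g : S.X (n + 1 + 1) →ₗ[R] F, g ∘ₗ S.d (n + 1) = f) : S.HomExact F := by
  intro n f
  constructor
  · exact hF n f
  · rintro ⟨g, rfl⟩
    change (g ∘ₗ S.d (n + 1)) ∘ₗ S.d n = 0
    rw [LinearMap.comp_assoc, h.comp_eq_zero, LinearMap.comp_zero]

theorem ModSeq.HomExact.exists_lift {S : ModSeq R} {F : Type u} [AddCommGroup F]
    [Module R F] (h : S.HomExact F) (n : ℤ) (f : S.X (n + 1) →ₗ[R] F) (hf : f ∘ₗ S.d n = 0) :
    ∃ g : S.X (n + 1 + 1) →ₗ[R] F, g ∘ₗ S.d (n + 1) = f :=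
  (h n f).1 hf

/-- An epi-mono factorisation is transported by functors more easily than an image. The degree is
spelled `-2 + 1` so that exactness and Hom-exactness at index `-2` apply without casts. -/
theorem isGProjective_iff {C M : Type u} [AddCommGroup C] [Module R C] [AddCommGroup M]
    [Module R M] : IsGProjective R C M ↔ ∃ S : ModSeq R, S.IsExact ∧ S.HomAddExact C ∧
      S.HasShape C ∧ ∃ (p : S.X (-2 + 1) →ₗ[R] M) (i : M →ₗ[R] S.X (-2 + 1 + 1)),
        Function.Surjective p ∧ Function.Injective i ∧ i ∘ₗ p = S.d (-2 + 1) := by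
  constructor
  · rintro ⟨S, h1, h2, h3, ⟨e⟩⟩
    refine ⟨S, h1, h2, h3, e.symm.toLinearMap ∘ₗ (S.d (-2 + 1)).rangeRestrict,
      (LinearMap.range (S.d (-2 + 1))).subtype ∘ₗ e.toLinearMap, ?_, ?_, ?_⟩
    · exact e.symm.surjective.comp (S.d (-2 + 1)).surjective_rangeRestrict
    · exact (Submodule.injective_subtype _).comp e.injective
    · refine LinearMap.ext fun x => ?_
      exact congrArg Subtype.val (e.apply_symm_apply ((S.d (-2 + 1)).rangeRestrict x))
  · rintro ⟨S, h1, h2, h3, p, i, hp, hi, hip⟩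
    refine ⟨S, h1, h2, h3, ⟨(LinearEquiv.ofInjective i hi).trans (LinearEquiv.ofEq _ _ ?_)⟩⟩
    have : LinearMap.range (S.d (-2 + 1)) = LinearMap.range i := by
      rw [← hip, LinearMap.range_comp_of_range_eq_top _ (LinearMap.range_eq_top.2 hp)]
    exact this.symm

theorem IsGProjective.of_equiv {C M N : Type u} [AddCommGroup C] [Module R C] [AddCommGroup M]
    [Module R M] [AddCommGroup N] [Module R N] (e : N ≃ₗ[R] M) (h : IsGProjective R C M) :
    IsGProjective R C N := by
  obtain ⟨S, h1, h2, h3, ⟨e'⟩⟩ := h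
  exact ⟨S, h1, h2, h3, ⟨e.trans e'⟩⟩

theorem exists_factor {K P M F : Type*} [AddCommGroup K] [Module R K] [AddCommGroup P] [Module R P]
    [AddCommGroup M] [Module R M] [AddCommGroup F] [Module R F] {i : K →ₗ[R] P} {p : P →ₗ[R] M}
    (hip : Function.Exact i p) (hp : Function.Surjective p) (f : P →ₗ[R] F) (hf : f ∘ₗ i = 0) :
    ∃ g : M →ₗ[R] F, g ∘ₗ p = f := by
  have hker : LinearMap.ker p ≤ LinearMap.ker f := fun x hx => by
    obtain ⟨k, rfl⟩ := (hip x).1 hx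
    exact LinearMap.congr_fun hf k
  refine ⟨(LinearMap.ker p).liftQ f hker ∘ₗ (p.quotKerEquivOfSurjective hp).symm.toLinearMap,
    LinearMap.ext fun x => ?_⟩
  have : (p.quotKerEquivOfSurjective hp).symm (p x) = Submodule.Quotient.mk x := by
    rw [LinearEquiv.symm_apply_eq]; rfl
  simp [this]

/-- The canonical free cover of a module. -/
noncomputable def freeCover (X : ModuleCat.{u} R) : (X →₀ R) →ₗ[R] X :=
  Finsupp.linearCombination R id

theorem freeCover_surjective (X : ModuleCat.{u} R) : Function.Surjective (freeCover X) :=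
  fun x => ⟨Finsupp.single x (1 : R), by simp [freeCover]⟩

/-- The iterated syzygies with respect to the canonical free covers. -/
noncomputable def syzygy (X : ModuleCat.{u} R) : ℕ → ModuleCat.{u} R
  | 0 => X
  | n + 1 => ModuleCat.of R (LinearMap.ker (freeCover (syzygy X n)))

/-- The inclusion of a syzygy. -/
noncomputable def syzygyInclusion (X : ModuleCat.{u} R) (n : ℕ) :
    syzygy X (n + 1) →ₗ[R] (syzygy X n →₀ R) :=
  (LinearMap.ker (freeCover (syzygy X n))).subtype

theorem syzygyInclusion_injective (X : ModuleCat.{u} R) (n : ℕ) :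
    Function.Injective (syzygyInclusion X n) :=
  (LinearMap.ker (freeCover (syzygy X n))).injective_subtype

theorem syzygyInclusion_exact (X : ModuleCat.{u} R) (n : ℕ) :
    Function.Exact (syzygyInclusion X n) (freeCover (syzygy X n)) :=
  (freeCover (syzygy X n)).exact_subtype_ker_map

theorem extVanishes_syzygy {X : ModuleCat.{u} R} {F : Type u} [AddCommGroup F] [Module R F]
    (h : ∀ m, ExtVanishes R X F (m + 1)) (k : ℕ) : ∀ m, ExtVanishes R (syzygy X k) F (m + 1) := by
  induction k with
  | zero => exact h
  | succ k ih =>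
    intro m
    have : Module.Projective R (syzygy X k →₀ R) := .of_free
    exact extVanishes_kernel (syzygyInclusion_injective X k) (syzygyInclusion_exact X k)
      (freeCover_surjective _) (ih (m + 1))

/-- The canonical free resolution of `X`, continued to the right by `X → 0 → 0 → ⋯`. -/
noncomputable def resolution (X : ModuleCat.{u} R) : ModSeq R where
  X
    | Int.negSucc k => ModuleCat.of R (syzygy X k →₀ R)
    | Int.ofNat 0 => X
    | Int.ofNat (_ + 1) => ModuleCat.of R PUnit
  d
    -- Degree `-1 - k` carries the free cover of the `k`-th syzygy; `negSucc (k + 1) + 1` reduces to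
    -- `negSucc k`, so the types match by computation.
    | Int.negSucc (k + 1) => syzygyInclusion X k ∘ₗ freeCover (syzygy X (k + 1))
    | Int.negSucc 0 => freeCover X
    | Int.ofNat _ => 0

theorem resolution_exact_aux (X : ModuleCat.{u} R) (k : ℕ) :
    Function.Exact (syzygyInclusion X (k + 1) ∘ₗ freeCover (syzygy X (k + 1 + 1)))
      (freeCover (syzygy X (k + 1))) := by
  intro x
  rw [syzygyInclusion_exact X (k + 1) x]
  constructor
  · rintro ⟨y, rfl⟩
    obtain ⟨z, rfl⟩ := freeCover_surjective _ y
    exact ⟨z, rfl⟩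
  · rintro ⟨y, rfl⟩
    exact ⟨_, rfl⟩

theorem resolution_exact_aux_zero (X : ModuleCat.{u} R) :
    Function.Exact (syzygyInclusion X 0 ∘ₗ freeCover (syzygy X 1)) (freeCover X) := by
  intro x
  rw [show freeCover X x = 0 ↔ _ from syzygyInclusion_exact X 0 x]
  constructor
  · rintro ⟨y, rfl⟩
    obtain ⟨z, rfl⟩ := freeCover_surjective _ y
    exact ⟨z, rfl⟩
  · rintro ⟨y, rfl⟩
    exact ⟨_, rfl⟩

theorem resolution_isExact (X : ModuleCat.{u} R) : (resolution X).IsExact := by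
  -- Index `n` concerns the term in degree `n + 1`; the cases are the degrees `≥ 1`, `0`, `-1` and
  -- `≤ -2`.
  rintro (n | (_ | _ | k))
  · intro x
    refine ⟨fun _ => ⟨0, ?_⟩, fun _ => rfl⟩
    exact Subsingleton.elim (α := PUnit) _ _
  · exact fun x => ⟨fun _ => freeCover_surjective X x, fun _ => rfl⟩
  · exact resolution_exact_aux_zero X
  · intro x
    refine Iff.trans ?_ (resolution_exact_aux X k x)
    exact map_eq_zero_iff _ (syzygyInclusion_injective X k)

/-- A cocycle on a free term factors through the syzygy that this term covers. Extending the factor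
to the next free term is obstructed by `Ext¹` of the following syzygy, which is a higher `Ext` of
`X` by dimension shifting. -/
theorem resolution_homExact {X : ModuleCat.{u} R} {F : Type u} [AddCommGroup F] [Module R F]
    (h : ∀ m, ExtVanishes R X F (m + 1)) : (resolution X).HomExact F := by
  refine (resolution_isExact X).homExact ?_
  rintro (n | (_ | _ | k)) f hf
  · refine ⟨0, ?_⟩
    refine LinearMap.ext fun x => ?_
    rw [show x = 0 from Subsingleton.elim (α := PUnit) _ _, map_zero, map_zero]
  · refine ⟨0, ?_⟩
    refine LinearMap.ext fun x => ?_
    obtain ⟨y, rfl⟩ := freeCover_surjective X x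
    exact (LinearMap.congr_fun hf y).symm
  · exact exists_factor (resolution_exact_aux_zero X) (freeCover_surjective X) f hf
  · obtain ⟨g, hg⟩ := exists_factor (resolution_exact_aux X k) (freeCover_surjective _) f hf
    obtain ⟨g', hg'⟩ := exists_extend_of_extVanishes (syzygyInclusion_injective X k)
      (syzygyInclusion_exact X k) (freeCover_surjective _) (extVanishes_syzygy h k 0) g
    refine ⟨g', ?_⟩
    rw [← hg, ← hg']
    rfl

theorem SigmaSelfOrthogonal.extVanishes {C : Type u} [AddCommGroup C] [Module R C]
    (hC : SigmaSelfOrthogonal R C) {X : Type u} [AddCommGroup X] [Module R X]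
    (hX : IsBigAdd R C X) (I : Type u) (m : ℕ) : ExtVanishes R X (I →₀ C) (m + 1) := by
  obtain ⟨J, i, r, hri⟩ := isBigAdd_iff.1 hX
  exact extVanishes_retract hri (extVanishes_finsupp J m C (hC I (m + 1) (by omega)))

/-- If `C` is `Σ`-self-orthogonal, the modules in `Add_R(C)` are `G_C`-projective. -/
theorem SigmaSelfOrthogonal.isGProjective {C : Type u} [AddCommGroup C] [Module R C]
    (hC : SigmaSelfOrthogonal R C) {X : Type u} [AddCommGroup X] [Module R X]
    (hX : IsBigAdd R C X) : IsGProjective R C X := by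
  refine isGProjective_iff.2 ⟨resolution (ModuleCat.of R X), resolution_isExact _, ?_, ⟨?_, ?_⟩,
    freeCover (ModuleCat.of R X), LinearMap.id, freeCover_surjective _, Function.injective_id, rfl⟩
  · intro F hF
    obtain ⟨I, hI⟩ := isBigAdd_iff.1 hF
    exact (resolution_homExact fun m => hC.extVanishes hX I m).retract hI
  · rintro (n | k) hn
    · exact absurd hn (by simp)
    · exact inferInstanceAs (Module.Projective R (syzygy (ModuleCat.of R X) k →₀ R))
  · rintro ((_ | n) | k) hn
    · exact hX
    · exact isBigAdd_of_subsingleton C PUnit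
    · exact absurd hn (by simp)

end Sequences

/-! ### Functoriality and right exactness properties of `U ⊗_A -`. -/

section TensorLemmas

variable {A B U M N L : Type u} [Ring A] [Ring B] [AddCommGroup U] [Module B U] [Module Aᵐᵒᵖ U]
  [SMulCommClass B Aᵐᵒᵖ U] [AddCommGroup M] [Module A M] [AddCommGroup N] [Module A N]
  [AddCommGroup L] [Module A L]

theorem btensor_induction {motive : BTensor A B U M → Prop}
    (btmul : ∀ v m, motive (btmul A B v m)) (add : ∀ x y, motive x → motive y → motive (x + y))
    (x : BTensor A B U M) : motive x := by
  obtain ⟨x, rfl⟩ := (balSubmodule A B U M).mkQ_surjective x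
  induction x using TensorProduct.induction_on with
  | zero => rw [map_zero, ← btmul_zero (A := A) (B := B) (M := M) (0 : U)]; exact btmul _ _
  | tmul v m => exact btmul v m
  | add x y hx hy => rw [map_add]; exact add _ _ hx hy

theorem btensor_hom_ext {V : Type*} [AddCommGroup V] [Module B V]
    {f g : BTensor A B U M →ₗ[B] V} (h : ∀ v m, f (btmul A B v m) = g (btmul A B v m)) :
    f = g := by
  refine LinearMap.ext fun x => ?_
  induction x using btensor_induction with
  | btmul v m => exact h v m
  | add x y hx hy => rw [map_add, map_add, hx, hy]

theorem bmap_id : bmap B U (LinearMap.id : M →ₗ[A] M) = LinearMap.id :=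
  btensor_hom_ext fun _ _ => rfl

theorem bmap_comp (f : M →ₗ[A] N) (g : N →ₗ[A] L) :
    bmap B U (g ∘ₗ f) = bmap B U g ∘ₗ bmap B U f :=
  btensor_hom_ext fun _ _ => rfl

theorem bmap_zero : bmap B U (0 : M →ₗ[A] N) = 0 :=
  btensor_hom_ext fun v m => by rw [bmap_btmul]; exact btmul_zero v

theorem bmap_surjective {f : M →ₗ[A] N} (hf : Function.Surjective f) :
    Function.Surjective (bmap B U f) := by
  intro y
  induction y using btensor_induction with
  | btmul v n =>
    obtain ⟨m, rfl⟩ := hf n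
    exact ⟨btmul A B v m, rfl⟩
  | add x y hx hy =>
    obtain ⟨x, rfl⟩ := hx
    obtain ⟨y, rfl⟩ := hy
    exact ⟨x + y, map_add _ _ _⟩

/-- The `B`-linear map on `U ⊗_A M` given by a balanced biadditive map. -/
def btLift {V : Type*} [AddCommGroup V] [Module B V] (f : U →ₗ[B] M →ₗ[ℤ] V)
    (hf : ∀ (a : A) (v : U) (m : M), f (MulOpposite.op a • v) m = f v (a • m)) :
    BTensor A B U M →ₗ[B] V :=
  (balSubmodule A B U M).liftQ (TensorProduct.AlgebraTensorModule.lift f) (by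
    rw [balSubmodule, Submodule.span_le]
    rintro _ ⟨v, a, m, rfl⟩
    simp [hf])

end TensorLemmas

/-! ### The components of a `T`-module, its structure map and its cokernel. -/

section Components

variable (A B U : Type u) [Ring A] [Ring B] [AddCommGroup U] [Module B U] [Module Aᵐᵒᵖ U]
  [SMulCommClass B Aᵐᵒᵖ U]

/-- The projection of the triangular matrix ring onto `A`. -/
def TriRing.projA : TriRing A B U →+* A where
  toFun t := t.a
  map_one' := rfl
  map_mul' _ _ := rfl
  map_zero' := rfl
  map_add' _ _ := rfl

/-- The projection of the triangular matrix ring onto `B`. -/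
def TriRing.projB : TriRing A B U →+* B where
  toFun t := t.b
  map_one' := rfl
  map_mul' _ _ := rfl
  map_zero' := rfl
  map_add' _ _ := rfl

instance : RingHomSurjective (TriRing.projA A B U) := ⟨fun a => ⟨⟨a, 0, 0⟩, rfl⟩⟩
instance : RingHomSurjective (TriRing.projB A B U) := ⟨fun b => ⟨⟨0, 0, b⟩, rfl⟩⟩

variable (N : Type u) [AddCommGroup N] [Module (TriRing A B U) N]

/-- The first component `e₁ N` of a `T`-module. -/
def Fst : AddSubgroup N where
  carrier := {x | (⟨1, 0, 0⟩ : TriRing A B U) • x = x}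
  zero_mem' := smul_zero _
  add_mem' {x y} hx hy := by
    change _ • (x + y) = _
    rw [smul_add, show _ • x = x from hx, show _ • y = y from hy]
  neg_mem' {x} hx := by
    change _ • (-x) = _
    rw [smul_neg, show _ • x = x from hx]

/-- The second component `e₂ N` of a `T`-module. -/
def Snd : AddSubgroup N where
  carrier := {x | (⟨0, 0, 1⟩ : TriRing A B U) • x = x}
  zero_mem' := smul_zero _
  add_mem' {x y} hx hy := by
    change _ • (x + y) = _
    rw [smul_add, show _ • x = x from hx, show _ • y = y from hy]
  neg_mem' {x} hx := by
    change _ • (-x) = _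
    rw [smul_neg, show _ • x = x from hx]

variable {A B U N}

theorem mem_Fst {x : N} : x ∈ Fst A B U N ↔ (⟨1, 0, 0⟩ : TriRing A B U) • x = x := Iff.rfl

theorem mem_Snd {x : N} : x ∈ Snd A B U N ↔ (⟨0, 0, 1⟩ : TriRing A B U) • x = x := Iff.rfl

theorem smul_mem_Fst (a : A) (x : N) : (⟨a, 0, 0⟩ : TriRing A B U) • x ∈ Fst A B U N := by
  rw [mem_Fst, smul_smul]; congr 1; ext <;> simp

theorem smul_mem_Snd (v : U) (b : B) (x : N) : (⟨0, v, b⟩ : TriRing A B U) • x ∈ Snd A B U N := by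
  rw [mem_Snd, smul_smul]; congr 1; ext <;> simp

instance : SMul A (Fst A B U N) :=
  ⟨fun a x => ⟨(⟨a, 0, 0⟩ : TriRing A B U) • x.1, smul_mem_Fst a _⟩⟩

instance : SMul B (Snd A B U N) :=
  ⟨fun b x => ⟨(⟨0, 0, b⟩ : TriRing A B U) • x.1, smul_mem_Snd 0 b _⟩⟩

theorem Fst.coe_smul (a : A) (x : Fst A B U N) :
    ((a • x : Fst A B U N) : N) = (⟨a, 0, 0⟩ : TriRing A B U) • (x : N) := rfl

theorem Snd.coe_smul (b : B) (x : Snd A B U N) :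
    ((b • x : Snd A B U N) : N) = (⟨0, 0, b⟩ : TriRing A B U) • (x : N) := rfl

instance : Module A (Fst A B U N) where
  one_smul x := Subtype.ext x.2
  mul_smul a b x := Subtype.ext (by
    simp only [Fst.coe_smul, smul_smul]; congr 1; ext <;> simp)
  smul_zero a := Subtype.ext (smul_zero _)
  smul_add a x y := Subtype.ext (smul_add _ _ _)
  add_smul a b x := Subtype.ext (by
    simp only [Fst.coe_smul, AddSubgroup.coe_add, ← add_smul]; congr 1; ext <;> simp)
  zero_smul x := Subtype.ext (zero_smul _ _)

instance : Module B (Snd A B U N) where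
  one_smul x := Subtype.ext x.2
  mul_smul a b x := Subtype.ext (by
    simp only [Snd.coe_smul, smul_smul]; congr 1; ext <;> simp)
  smul_zero a := Subtype.ext (smul_zero _)
  smul_add a x y := Subtype.ext (smul_add _ _ _)
  add_smul a b x := Subtype.ext (by
    simp only [Snd.coe_smul, AddSubgroup.coe_add, ← add_smul]; congr 1; ext <;> simp)
  zero_smul x := Subtype.ext (zero_smul _ _)

/-- Multiplication by `e₁`. -/
def toFst : N →ₛₗ[TriRing.projA A B U] Fst A B U N where
  toFun x := ⟨(⟨1, 0, 0⟩ : TriRing A B U) • x, smul_mem_Fst 1 x⟩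
  map_add' x y := Subtype.ext (smul_add _ _ _)
  map_smul' t x := Subtype.ext (by
    rw [Fst.coe_smul]
    simp only [smul_smul]; congr 1; ext <;> simp [TriRing.projA])

/-- Multiplication by `e₂`. -/
def toSnd : N →+ Snd A B U N where
  toFun x := ⟨(⟨0, 0, 1⟩ : TriRing A B U) • x, smul_mem_Snd 0 1 x⟩
  map_zero' := Subtype.ext (smul_zero _)
  map_add' _ _ := Subtype.ext (smul_add _ _ _)

theorem coe_toFst (x : N) : (toFst (A := A) (B := B) (U := U) x : N) =
    (⟨1, 0, 0⟩ : TriRing A B U) • x := rfl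

theorem coe_toSnd (x : N) : (toSnd (A := A) (B := B) (U := U) x : N) =
    (⟨0, 0, 1⟩ : TriRing A B U) • x := rfl

theorem toFst_coe (x : Fst A B U N) : toFst (A := A) (B := B) (U := U) (x : N) = x :=
  Subtype.ext x.2

theorem toSnd_coe (x : Snd A B U N) : toSnd (A := A) (B := B) (U := U) (x : N) = x :=
  Subtype.ext x.2

theorem toFst_coe_Snd (x : Snd A B U N) : toFst (A := A) (B := B) (U := U) (x : N) = 0 := by
  refine Subtype.ext ?_
  rw [coe_toFst, ← mem_Snd.1 x.2, smul_smul, AddSubgroup.coe_zero,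
    ← zero_smul (TriRing A B U) (x : N)]
  congr 1; ext <;> simp

theorem toSnd_coe_Fst (x : Fst A B U N) : toSnd (A := A) (B := B) (U := U) (x : N) = 0 := by
  refine Subtype.ext ?_
  rw [coe_toSnd, ← mem_Fst.1 x.2, smul_smul, AddSubgroup.coe_zero,
    ← zero_smul (TriRing A B U) (x : N)]
  congr 1; ext <;> simp

theorem coe_toFst_add_coe_toSnd (x : N) :
    (toFst (A := A) (B := B) (U := U) x : N) + (toSnd (A := A) (B := B) (U := U) x : N) = x := by
  rw [coe_toFst, coe_toSnd, ← add_smul]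
  conv_rhs => rw [← one_smul (TriRing A B U) x]
  congr 1; ext <;> simp

variable (A B U N) in
/-- The structure map `U ⊗_A e₁ N → e₂ N` of a `T`-module. -/
def phi : BTensor A B U (Fst A B U N) →ₗ[B] Snd A B U N :=
  btLift
    { toFun := fun v => AddMonoidHom.toIntLinearMap
        { toFun := fun x => ⟨(⟨0, v, 0⟩ : TriRing A B U) • (x : N), smul_mem_Snd v 0 _⟩
          map_zero' := Subtype.ext (smul_zero _)
          map_add' := fun _ _ => Subtype.ext (smul_add _ _ _) }
      map_add' := fun v w => LinearMap.ext fun x => Subtype.ext (by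
        change _ • (x : N) = _ • (x : N) + _ • (x : N)
        rw [← add_smul]; congr 1; ext <;> simp)
      map_smul' := fun b v => LinearMap.ext fun x => Subtype.ext (by
        change _ • (x : N) = _ • _ • (x : N)
        rw [smul_smul]; congr 1; ext <;> simp) }
    (fun a v m => Subtype.ext (by
        change _ • (m : N) = _ • _ • (m : N)
        rw [smul_smul]; congr 1; ext <;> simp))

theorem coe_phi_btmul (v : U) (x : Fst A B U N) :
    (phi A B U N (btmul A B v x) : N) = (⟨0, v, 0⟩ : TriRing A B U) • (x : N) := rfl

theorem toSnd_smul (t : TriRing A B U) (x : N) :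
    toSnd (A := A) (B := B) (U := U) (t • x) =
      phi A B U N (btmul A B t.u (toFst x)) + t.b • toSnd (A := A) (B := B) (U := U) x := by
  refine Subtype.ext ?_
  rw [AddSubgroup.coe_add, coe_phi_btmul, Snd.coe_smul, coe_toSnd, coe_toFst, coe_toSnd,
    smul_smul, smul_smul, smul_smul, ← add_smul]
  congr 1; ext <;> simp

theorem toFst_smul (t : TriRing A B U) (x : N) :
    toFst (A := A) (B := B) (U := U) (t • x) = t.a • toFst (A := A) (B := B) (U := U) x :=
  map_smulₛₗ _ _ _

variable (A B U N) in
/-- The cokernel of the structure map of a `T`-module. -/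
abbrev Bar : Type u := Snd A B U N ⧸ LinearMap.range (phi A B U N)

/-- The projection onto the cokernel of the structure map. -/
def toBar : Snd A B U N →ₗ[B] Bar A B U N := (LinearMap.range (phi A B U N)).mkQ

theorem toBar_surjective : Function.Surjective (toBar (A := A) (B := B) (U := U) (N := N)) :=
  Submodule.mkQ_surjective _

theorem toBar_eq_zero_iff {x : Snd A B U N} : toBar x = 0 ↔ ∃ y, phi A B U N y = x :=
  Submodule.Quotient.mk_eq_zero _

theorem toBar_phi (y) : toBar (phi A B U N y) = 0 := toBar_eq_zero_iff.2 ⟨y, rfl⟩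

/-- A map out of the cokernel of the structure map. -/
def barLift {V : Type*} [AddCommGroup V] [Module B V] (f : Snd A B U N →ₗ[B] V)
    (hf : f ∘ₗ phi A B U N = 0) : Bar A B U N →ₗ[B] V :=
  (LinearMap.range (phi A B U N)).liftQ f (by
    rintro _ ⟨y, rfl⟩; exact LinearMap.congr_fun hf y)

theorem bar_hom_ext {V : Type*} [AddCommGroup V] [Module B V] {f g : Bar A B U N →ₗ[B] V}
    (h : ∀ x, f (toBar x) = g (toBar x)) : f = g := by
  refine LinearMap.ext fun x => ?_
  obtain ⟨x, rfl⟩ := toBar_surjective x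
  exact h x

section Maps

variable {N' N'' : Type u} [AddCommGroup N'] [Module (TriRing A B U) N']
  [AddCommGroup N''] [Module (TriRing A B U) N'']

/-- The map induced on first components. -/
def fstMap (f : N →ₗ[TriRing A B U] N') : Fst A B U N →ₗ[A] Fst A B U N' where
  toFun x := ⟨f x, by rw [mem_Fst, ← map_smul, mem_Fst.1 x.2]⟩
  map_add' x y := Subtype.ext (map_add f _ _)
  map_smul' a x := Subtype.ext (map_smul f _ _)

/-- The map induced on second components. -/
def sndMap (f : N →ₗ[TriRing A B U] N') : Snd A B U N →ₗ[B] Snd A B U N' where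
  toFun x := ⟨f x, by rw [mem_Snd, ← map_smul, mem_Snd.1 x.2]⟩
  map_add' x y := Subtype.ext (map_add f _ _)
  map_smul' a x := Subtype.ext (map_smul f _ _)

theorem toFst_map (f : N →ₗ[TriRing A B U] N') (x : N) : toFst (f x) = fstMap f (toFst x) :=
  Subtype.ext (map_smul f _ _).symm

theorem toSnd_map (f : N →ₗ[TriRing A B U] N') (x : N) : toSnd (f x) = sndMap f (toSnd x) :=
  Subtype.ext (map_smul f _ _).symm

theorem sndMap_phi (f : N →ₗ[TriRing A B U] N') (y) :
    sndMap f (phi A B U N y) = phi A B U N' (bmap B U (fstMap f) y) := by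
  have : sndMap f ∘ₗ phi A B U N = phi A B U N' ∘ₗ bmap B U (fstMap f) :=
    btensor_hom_ext fun v x => Subtype.ext (map_smul f _ _)
  exact LinearMap.congr_fun this y

/-- The map induced on cokernels of structure maps. -/
def barMap (f : N →ₗ[TriRing A B U] N') : Bar A B U N →ₗ[B] Bar A B U N' :=
  barLift (toBar ∘ₗ sndMap f) (LinearMap.ext fun y => by
    simp only [LinearMap.comp_apply, sndMap_phi, toBar_phi, LinearMap.zero_apply])

theorem barMap_toBar (f : N →ₗ[TriRing A B U] N') (x) :
    barMap f (toBar x) = toBar (sndMap f x) := rfl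

theorem fstMap_surjective {f : N →ₗ[TriRing A B U] N'} (hf : Function.Surjective f) :
    Function.Surjective (fstMap f) := fun y => by
  obtain ⟨x, hx⟩ := hf y
  exact ⟨toFst x, by rw [← toFst_map, hx, toFst_coe]⟩

theorem sndMap_surjective {f : N →ₗ[TriRing A B U] N'} (hf : Function.Surjective f) :
    Function.Surjective (sndMap f) := fun y => by
  obtain ⟨x, hx⟩ := hf y
  exact ⟨toSnd x, by rw [← toSnd_map, hx, toSnd_coe]⟩

theorem barMap_surjective {f : N →ₗ[TriRing A B U] N'} (hf : Function.Surjective f) :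
    Function.Surjective (barMap f) := fun y => by
  obtain ⟨y, rfl⟩ := toBar_surjective y
  obtain ⟨x, rfl⟩ := sndMap_surjective hf y
  exact ⟨toBar x, rfl⟩

/-- Multiplying a preimage by the idempotent `e₁` moves it into the first component without changing
its image. -/
theorem fstMap_exact {f : N →ₗ[TriRing A B U] N'} {g : N' →ₗ[TriRing A B U] N''}
    (h : Function.Exact f g) : Function.Exact (fstMap f) (fstMap g) := by
  intro y
  constructor
  · intro hy
    obtain ⟨x, hx⟩ := (h y).1 (congrArg Subtype.val hy)
    exact ⟨toFst x, by rw [← toFst_map, hx, toFst_coe]⟩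
  · rintro ⟨x, rfl⟩
    exact Subtype.ext (h.apply_apply_eq_zero _)

theorem sndMap_exact {f : N →ₗ[TriRing A B U] N'} {g : N' →ₗ[TriRing A B U] N''}
    (h : Function.Exact f g) : Function.Exact (sndMap f) (sndMap g) := by
  intro y
  constructor
  · intro hy
    obtain ⟨x, hx⟩ := (h y).1 (congrArg Subtype.val hy)
    exact ⟨toSnd x, by rw [← toSnd_map, hx, toSnd_coe]⟩
  · rintro ⟨x, rfl⟩
    exact Subtype.ext (h.apply_apply_eq_zero _)

end Maps

end Components

/-! ### Maps into and out of `p(M₁, M₂)`, retracts and projectives. -/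

section TriModMaps

variable {A B U : Type u} [Ring A] [Ring B] [AddCommGroup U] [Module B U] [Module Aᵐᵒᵖ U]
  [SMulCommClass B Aᵐᵒᵖ U] {N : Type u} [AddCommGroup N] [Module (TriRing A B U) N]
  {M₁ M₂ : Type u} [AddCommGroup M₁] [Module A M₁] [AddCommGroup M₂] [Module B M₂]
  {φ : BTensor A B U M₁ →ₗ[B] M₂}

/-- A `T`-linear map into `(M₁; M₂)_φ` from its components. -/
def homToTri (f : Fst A B U N →ₗ[A] M₁) (g : Snd A B U N →ₗ[B] M₂)
    (h : g ∘ₗ phi A B U N = φ ∘ₗ bmap B U f) : N →ₗ[TriRing A B U] TriMod φ where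
  toFun x := ⟨f (toFst x), g (toSnd x)⟩
  map_add' x y := by ext <;> simp
  map_smul' t x := by
    ext
    · exact (congrArg f (toFst_smul t x)).trans (map_smul f _ _)
    · have := LinearMap.congr_fun h (btmul A B t.u (toFst x))
      simp only [LinearMap.comp_apply, bmap_btmul] at this
      simp [toSnd_smul, this]

/-- The first component of a map into `(M₁; M₂)_φ`. -/
def homFst (h : N →ₗ[TriRing A B U] TriMod φ) : Fst A B U N →ₗ[A] M₁ where
  toFun x := (h x).fst
  map_add' x y := by simp
  map_smul' a x := by rw [Fst.coe_smul, map_smul]; rfl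

/-- The second component of a map into `(M₁; M₂)_φ`. -/
def homSnd (h : N →ₗ[TriRing A B U] TriMod φ) : Snd A B U N →ₗ[B] M₂ where
  toFun x := (h x).snd
  map_add' x y := by simp
  map_smul' a x := by rw [Snd.coe_smul, map_smul]; simp [zero_btmul]

theorem homSnd_apply (h : N →ₗ[TriRing A B U] TriMod φ) (x) : homSnd h x = (h x).snd := rfl

theorem snd_apply_coe_Fst (h : N →ₗ[TriRing A B U] TriMod φ) (x : Fst A B U N) :
    (h x).snd = 0 := by
  rw [← mem_Fst.1 x.2, map_smul]; simp [zero_btmul]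

theorem fst_apply_coe_Snd (h : N →ₗ[TriRing A B U] TriMod φ) (x : Snd A B U N) :
    (h x).fst = 0 := by
  rw [← mem_Snd.1 x.2, map_smul]; simp

theorem homSnd_phi (h : N →ₗ[TriRing A B U] TriMod φ) (y) :
    homSnd h (phi A B U N y) = φ (bmap B U (homFst h) y) := by
  have : homSnd h ∘ₗ phi A B U N = φ ∘ₗ bmap B U (homFst h) :=
    btensor_hom_ext fun v x => by
      change (h ((⟨0, v, 0⟩ : TriRing A B U) • (x : N))).snd = φ (btmul A B v (h x).fst)
      rw [map_smul]; simp
  exact LinearMap.congr_fun this y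

theorem homToTri_ext {h h' : N →ₗ[TriRing A B U] TriMod φ} (h₁ : homFst h = homFst h')
    (h₂ : homSnd h = homSnd h') : h = h' := by
  refine LinearMap.ext fun x => ?_
  rw [← coe_toFst_add_coe_toSnd (A := A) (B := B) (U := U) x, map_add, map_add]
  congr 1
  · refine TriMod.ext (LinearMap.congr_fun h₁ _) ?_
    rw [snd_apply_coe_Fst, snd_apply_coe_Fst]
  · refine TriMod.ext ?_ (LinearMap.congr_fun h₂ _)
    rw [fst_apply_coe_Snd, fst_apply_coe_Snd]

/-- The first component of a map out of `(M₁; M₂)_φ`. -/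
def fstHom (h : TriMod φ →ₗ[TriRing A B U] N) : M₁ →ₗ[A] Fst A B U N where
  toFun x := ⟨h ⟨x, 0⟩, by
    rw [mem_Fst, ← map_smul]; congr 1; ext <;> simp [zero_btmul]⟩
  map_add' x y := Subtype.ext (by
    change h _ = h _ + h _
    rw [← map_add]; congr 1; ext <;> simp)
  map_smul' a x := Subtype.ext (by
    change h _ = _ • h _
    rw [← map_smul]; congr 1; ext <;> simp [zero_btmul])

/-- The second component of a map out of `(M₁; M₂)_φ`. -/
def sndHom (h : TriMod φ →ₗ[TriRing A B U] N) : M₂ →ₗ[B] Snd A B U N where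
  toFun x := ⟨h ⟨0, x⟩, by
    rw [mem_Snd, ← map_smul]; congr 1; ext <;> simp [zero_btmul]⟩
  map_add' x y := Subtype.ext (by
    change h _ = h _ + h _
    rw [← map_add]; congr 1; ext <;> simp)
  map_smul' a x := Subtype.ext (by
    change h _ = _ • h _
    rw [← map_smul]; congr 1; ext <;> simp [zero_btmul])

theorem coe_fstHom (h : TriMod φ →ₗ[TriRing A B U] N) (x) : (fstHom h x : N) = h ⟨x, 0⟩ := rfl

theorem coe_sndHom (h : TriMod φ →ₗ[TriRing A B U] N) (x) : (sndHom h x : N) = h ⟨0, x⟩ := rfl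

theorem sndHom_apply_phi (h : TriMod φ →ₗ[TriRing A B U] N) (y) :
    sndHom h (φ y) = phi A B U N (bmap B U (fstHom h) y) := by
  have : sndHom h ∘ₗ φ = phi A B U N ∘ₗ bmap B U (fstHom h) :=
    btensor_hom_ext fun v x => Subtype.ext (by
      change h ⟨0, _⟩ = (⟨0, v, 0⟩ : TriRing A B U) • h ⟨x, 0⟩
      rw [← map_smul]; congr 1; ext <;> simp)
  exact LinearMap.congr_fun this y

/-- A `T`-linear map out of `p(M₁, M₂)` from its components. -/
def pLift (f : M₁ →ₗ[A] Fst A B U N) (g : M₂ →ₗ[B] Snd A B U N) :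
    pMod A B U M₁ M₂ →ₗ[TriRing A B U] N where
  toFun x := (f x.fst : N) + (((phi A B U N (bmap B U f x.snd.1) + g x.snd.2) : Snd A B U N) : N)
  map_add' x y := by
    simp only [TriMod.add_fst, TriMod.add_snd, map_add, Prod.fst_add, Prod.snd_add,
      AddSubgroup.coe_add]
    abel
  map_smul' t x := by
    generalize hw : phi A B U N (bmap B U f x.snd.1) + g x.snd.2 = w
    have h1 : phi A B U N (bmap B U f (t • x).snd.1) + g (t • x).snd.2 =
        phi A B U N (btmul A B t.u (f x.fst)) + t.b • w := by
      simp [← hw, bmap_btmul, add_assoc]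
    rw [h1, TriMod.smul_fst, map_smul, Fst.coe_smul, AddSubgroup.coe_add, coe_phi_btmul,
      Snd.coe_smul, RingHom.id_apply, smul_add]
    -- Since `t e₁` keeps only the first column of `t` and `t e₂` only the second, `t` acts on each
    -- component through that column.
    have h2 : t • (f x.fst : N) = (⟨t.a, t.u, 0⟩ : TriRing A B U) • (f x.fst : N) := by
      rw [← mem_Fst.1 (f x.fst).2, smul_smul, smul_smul]; congr 1; ext <;> simp
    have h3 : t • (w : N) = (⟨0, 0, t.b⟩ : TriRing A B U) • (w : N) := by
      rw [← mem_Snd.1 w.2, smul_smul, smul_smul]; congr 1; ext <;> simp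
    rw [h2, h3, ← add_assoc, ← add_smul]
    congr 2
    ext <;> simp

theorem pLift_apply (f : M₁ →ₗ[A] Fst A B U N) (g : M₂ →ₗ[B] Snd A B U N)
    (x : pMod A B U M₁ M₂) : pLift f g x =
      (f x.fst : N) + (((phi A B U N (bmap B U f x.snd.1) + g x.snd.2) : Snd A B U N) : N) := rfl

theorem pLift_fst (f : M₁ →ₗ[A] Fst A B U N) (g : M₂ →ₗ[B] Snd A B U N) (x : M₁) :
    pLift f g ⟨x, 0⟩ = f x := by
  simp [pLift_apply]

theorem pLift_snd (f : M₁ →ₗ[A] Fst A B U N) (g : M₂ →ₗ[B] Snd A B U N) (x : M₂) :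
    pLift f g ⟨0, (0, x)⟩ = g x := by
  simp [pLift_apply]

/-- The values on `U ⊗ M₁` are forced by those on `M₁`, because `U` maps `M₁` onto generators of `U
⊗ M₁`. -/
theorem pMod_hom_ext {h h' : pMod A B U M₁ M₂ →ₗ[TriRing A B U] N}
    (h₁ : ∀ x, h ⟨x, 0⟩ = h' ⟨x, 0⟩) (h₂ : ∀ x, h ⟨0, (0, x)⟩ = h' ⟨0, (0, x)⟩) : h = h' := by
  have e₁ : fstHom h = fstHom h' := LinearMap.ext fun x => Subtype.ext (h₁ x)
  have e₂ : ∀ y, h ⟨0, (y, 0)⟩ = h' ⟨0, (y, 0)⟩ := fun y => by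
    have := sndHom_apply_phi h y
    rw [e₁, ← sndHom_apply_phi h' y] at this
    exact congrArg Subtype.val this
  refine LinearMap.ext fun x => ?_
  have hx : x = ⟨x.fst, 0⟩ + ⟨0, (x.snd.1, 0)⟩ + ⟨0, (0, x.snd.2)⟩ := by
    ext <;> simp
  rw [hx, map_add, map_add, map_add, map_add, h₁, h₂, e₂]

section PMap

variable {M₁' M₂' : Type u} [AddCommGroup M₁'] [Module A M₁'] [AddCommGroup M₂'] [Module B M₂']

variable (U) in
/-- The functor `p` on morphisms. -/
def pMap (f : M₁ →ₗ[A] M₁') (g : M₂ →ₗ[B] M₂') :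
    pMod A B U M₁ M₂ →ₗ[TriRing A B U] pMod A B U M₁' M₂' where
  toFun x := ⟨f x.fst, (bmap B U f x.snd.1, g x.snd.2)⟩
  map_add' x y := by ext <;> simp
  map_smul' t x := by ext <;> simp [bmap_btmul]

theorem pMap_apply (f : M₁ →ₗ[A] M₁') (g : M₂ →ₗ[B] M₂') (x : pMod A B U M₁ M₂) :
    pMap U f g x = ⟨f x.fst, (bmap B U f x.snd.1, g x.snd.2)⟩ := rfl

theorem pMap_fst (f : M₁ →ₗ[A] M₁') (g : M₂ →ₗ[B] M₂') (x : M₁) :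
    pMap U f g ⟨x, 0⟩ = ⟨f x, 0⟩ := by
  ext <;> simp [pMap_apply]

theorem pMap_snd (f : M₁ →ₗ[A] M₁') (g : M₂ →ₗ[B] M₂') (x : M₂) :
    pMap U f g ⟨0, (0, x)⟩ = ⟨0, (0, g x)⟩ := by
  ext <;> simp [pMap_apply]

theorem isRetract_pMod (h₁ : IsRetract A M₁ M₁') (h₂ : IsRetract B M₂ M₂') :
    IsRetract (TriRing A B U) (pMod A B U M₁ M₂) (pMod A B U M₁' M₂') := by
  obtain ⟨i, r, h⟩ := h₁
  obtain ⟨j, s, h'⟩ := h₂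
  refine ⟨pMap U i j, pMap U r s, pMod_hom_ext (fun x => ?_) (fun x => ?_)⟩
  · ext <;> simp [pMap_apply, show r (i x) = x from LinearMap.congr_fun h x]
  · ext <;> simp [pMap_apply, show s (j x) = x from LinearMap.congr_fun h' x]

end PMap

theorem IsRetract.fst_of_pMod (h : IsRetract (TriRing A B U) N (RelGor.pMod A B U M₁ M₂)) :
    IsRetract A (Fst A B U N) M₁ := by
  obtain ⟨i, r, h⟩ := h
  refine ⟨homFst i, fstHom r, LinearMap.ext fun x => Subtype.ext ?_⟩
  change r ⟨(i x).fst, 0⟩ = x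
  rw [← snd_apply_coe_Fst i x]
  exact LinearMap.congr_fun h (x : N)

theorem IsRetract.snd_of_pMod (h : IsRetract (TriRing A B U) N (RelGor.pMod A B U M₁ M₂)) :
    IsRetract B (Snd A B U N) (BTensor A B U M₁ × M₂) := by
  obtain ⟨i, r, h⟩ := h
  refine ⟨homSnd i, sndHom r, LinearMap.ext fun x => Subtype.ext ?_⟩
  change r ⟨0, (i x).snd⟩ = x
  rw [← fst_apply_coe_Snd i x]
  exact LinearMap.congr_fun h (x : N)

theorem IsRetract.bar_of_pMod (h : IsRetract (TriRing A B U) N (RelGor.pMod A B U M₁ M₂)) :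
    IsRetract B (Bar A B U N) M₂ := by
  obtain ⟨i, r, h⟩ := h
  refine ⟨barLift (LinearMap.snd B _ _ ∘ₗ homSnd i) (LinearMap.ext fun y => ?_),
    toBar ∘ₗ sndHom r ∘ₗ LinearMap.inr B _ _, bar_hom_ext fun x => ?_⟩
  · simp [homSnd_phi]
  · change toBar (sndHom r (0, (i x).snd.2)) = toBar x
    have hx : x = sndHom r (homSnd i x) := Subtype.ext (by
      change _ = r ⟨0, (i x).snd⟩
      rw [← fst_apply_coe_Snd i x]
      exact (LinearMap.congr_fun h (x : N)).symm)
    -- The `U ⊗ M₁` part is sent by `r` into the image of `phi`, so it vanishes in the cokernel.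
    have h2 : homSnd i x = LinearMap.inl B _ _ (i x).snd.1 + (0, (i x).snd.2) := by
      ext <;> simp [homSnd_apply]
    conv_rhs => rw [hx, h2, map_add, sndHom_apply_phi, map_add, toBar_phi, zero_add]

/-- The structure map of `p(M₁, M₂)` is a split inclusion, and a retract of a split monomorphism in
the category of maps is again one. -/
theorem IsRetract.phi_split_of_pMod (h : IsRetract (TriRing A B U) N (RelGor.pMod A B U M₁ M₂)) :
    ∃ ρ, ρ ∘ₗ phi A B U N = LinearMap.id := by
  obtain ⟨i, r, h⟩ := h
  have h' : fstHom r ∘ₗ homFst i = LinearMap.id := LinearMap.ext fun x => Subtype.ext (by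
    change r ⟨(i x).fst, 0⟩ = x
    rw [← snd_apply_coe_Fst i x]
    exact LinearMap.congr_fun h (x : N))
  refine ⟨bmap B U (fstHom r) ∘ₗ LinearMap.fst B _ _ ∘ₗ homSnd i, LinearMap.ext fun y => ?_⟩
  simp only [LinearMap.comp_apply, homSnd_phi, LinearMap.fst_apply, LinearMap.inl_apply]
  rw [← LinearMap.comp_apply, ← bmap_comp, h', bmap_id]

/-- A `T`-module whose structure map is a split monomorphism is of the form `p(M₁, M₂)`. -/
theorem exists_equiv_pMod (h : ∃ ρ, ρ ∘ₗ phi A B U N = LinearMap.id) :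
    Nonempty (N ≃ₗ[TriRing A B U] pMod A B U (Fst A B U N) (Bar A B U N)) := by
  obtain ⟨ρ, hρ⟩ := h
  have hρ' : ∀ y, ρ (phi A B U N y) = y := fun y => LinearMap.congr_fun hρ y
  let e : N →ₗ[TriRing A B U] pMod A B U (Fst A B U N) (Bar A B U N) :=
    homToTri LinearMap.id (ρ.prod toBar) (LinearMap.ext fun y => by
      simp [bmap_id, hρ', toBar_phi])
  refine ⟨LinearEquiv.ofBijective e ⟨?_, ?_⟩⟩
  · refine (injective_iff_map_eq_zero e).2 fun x hx => ?_
    have h1 : toFst (A := A) (B := B) (U := U) x = 0 := congrArg TriMod.fst hx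
    have h2 : (ρ.prod toBar) (toSnd x) = 0 := congrArg TriMod.snd hx
    obtain ⟨y, hy⟩ := toBar_eq_zero_iff.1 (congrArg Prod.snd h2)
    have h3 : ρ (toSnd x) = 0 := congrArg Prod.fst h2
    rw [← hy, hρ'] at h3
    rw [← coe_toFst_add_coe_toSnd (A := A) (B := B) (U := U) x, h1, ← hy, h3]
    simp
  · rintro ⟨x, y, z⟩
    obtain ⟨z, rfl⟩ := toBar_surjective z
    -- The correction `z - phi (ρ z)` lies in the kernel of `ρ` and has the class of `z`; adding
    -- `phi y` makes the value of `ρ` equal to `y`.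
    refine ⟨(x : N) + ((z - phi A B U N (ρ z) + phi A B U N y : Snd A B U N) : N), ?_⟩
    refine TriMod.ext ?_ ?_
    · change toFst _ = _
      rw [map_add, toFst_coe, toFst_coe_Snd, add_zero]
    · change (ρ.prod toBar) (toSnd _) = _
      rw [map_add, toSnd_coe, toSnd_coe_Fst, zero_add]
      simp [hρ', toBar_phi]

/-- `p` commutes with direct sums of copies. -/
theorem exists_finsupp_equiv_pMod (I : Type u) (M₁ M₂ : Type u) [AddCommGroup M₁] [Module A M₁]
    [AddCommGroup M₂] [Module B M₂] : Nonempty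
    ((I →₀ pMod A B U M₁ M₂) ≃ₗ[TriRing A B U] pMod A B U (I →₀ M₁) (I →₀ M₂)) := by
  refine ⟨LinearEquiv.ofLinearMap
    (Finsupp.lsum ℕ fun i => pMap U (Finsupp.lsingle i) (Finsupp.lsingle i))
    (pLift (Finsupp.lsum ℕ fun i => fstHom (Finsupp.lsingle i))
      (Finsupp.lsum ℕ fun i => sndHom (Finsupp.lsingle i) ∘ₗ LinearMap.inr B _ _)) ?_ ?_⟩
  · refine pMod_hom_ext (fun x => ?_) (fun x => ?_)
    · rw [LinearMap.comp_apply, pLift_fst]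
      induction x using Finsupp.induction_linear with
      | zero => simp; rfl
      | add x y hx hy =>
        rw [map_add, AddSubgroup.coe_add, map_add, hx, hy]; ext <;> simp
      | single i x =>
        rw [Finsupp.lsum_single, coe_fstHom, Finsupp.lsingle_apply, Finsupp.lsum_single]
        simp [pMap_apply]
    · rw [LinearMap.comp_apply, pLift_snd]
      induction x using Finsupp.induction_linear with
      | zero => simp; rfl
      | add x y hx hy =>
        rw [map_add, AddSubgroup.coe_add, map_add, hx, hy]; ext <;> simp
      | single i x =>
        rw [Finsupp.lsum_single, LinearMap.comp_apply, coe_sndHom, Finsupp.lsingle_apply,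
          Finsupp.lsum_single]
        simp [pMap_apply]
  · refine Finsupp.lhom_ext' fun i => pMod_hom_ext (fun x => ?_) (fun x => ?_)
    · simp only [LinearMap.comp_apply, Finsupp.lsingle_apply, Finsupp.lsum_single, pMap_fst,
        pLift_fst, coe_fstHom, LinearMap.id_apply]
    · simp only [LinearMap.comp_apply, Finsupp.lsingle_apply, Finsupp.lsum_single, pMap_snd,
        pLift_snd, coe_sndHom, LinearMap.id_apply, LinearMap.inr_apply]

/-- `p` is left adjoint to `N ↦ (Fst N, Snd N)`, which preserves surjections. -/
theorem projective_pMod [Module.Projective A M₁] [Module.Projective B M₂] :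
    Module.Projective (TriRing A B U) (pMod A B U M₁ M₂) := by
  refine .of_lifting_property'' fun f hf => ?_
  obtain ⟨g₁, h₁⟩ := Module.projective_lifting_property (fstMap f)
    (fstHom (LinearMap.id : pMod A B U M₁ M₂ →ₗ[TriRing A B U] _)) (fstMap_surjective hf)
  obtain ⟨g₂, h₂⟩ := Module.projective_lifting_property (sndMap f)
    (sndHom (LinearMap.id : pMod A B U M₁ M₂ →ₗ[TriRing A B U] _) ∘ₗ LinearMap.inr B _ _)
    (sndMap_surjective hf)
  refine ⟨pLift g₁ g₂, pMod_hom_ext (fun x => ?_) fun x => ?_⟩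
  · rw [LinearMap.comp_apply, pLift_fst]
    exact congrArg Subtype.val (LinearMap.congr_fun h₁ x)
  · rw [LinearMap.comp_apply, pLift_snd]
    exact congrArg Subtype.val (LinearMap.congr_fun h₂ x)

/-- The generators `e₁ x` and `e₂ x` give a surjection from `p` of free modules, which splits.
Projective terms can then be treated like terms in `Add(C)`. -/
theorem exists_retract_of_projective [Module.Projective (TriRing A B U) N] :
    IsRetract (TriRing A B U) N (pMod A B U (Fst A B U N →₀ A) (Snd A B U N →₀ B)) := by
  let p : pMod A B U (Fst A B U N →₀ A) (Snd A B U N →₀ B) →ₗ[TriRing A B U] N :=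
    pLift (Finsupp.linearCombination A id) (Finsupp.linearCombination B id)
  obtain ⟨i, hi⟩ := Module.projective_lifting_property p LinearMap.id fun x => by
    refine ⟨⟨Finsupp.single (toFst x) 1, (0, Finsupp.single (toSnd x) 1)⟩, ?_⟩
    simp only [p, pLift_apply, map_zero, zero_add, Finsupp.linearCombination_single, one_smul]
    exact coe_toFst_add_coe_toSnd x
  exact ⟨i, p, hi⟩

end TriModMaps

/-! ### Transfer of `Add`, `add` and finite generation between `T` and its components. -/

section AddP

variable {A B U C₁ C₂ : Type u} [Ring A] [Ring B] [AddCommGroup U] [Module B U] [Module Aᵐᵒᵖ U]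
  [SMulCommClass B Aᵐᵒᵖ U] [AddCommGroup C₁] [Module A C₁] [AddCommGroup C₂] [Module B C₂]
  {M₁ M₂ N : Type u} [AddCommGroup M₁] [Module A M₁] [AddCommGroup M₂] [Module B M₂]
  [AddCommGroup N] [Module (TriRing A B U) N]

theorem isRetract_pMod_finsupp {I J K : Type u} (i : I ↪ K) (j : J ↪ K)
    (h₁ : IsRetract A M₁ (I →₀ C₁)) (h₂ : IsRetract B M₂ (J →₀ C₂)) :
    IsRetract (TriRing A B U) (pMod A B U M₁ M₂) (K →₀ pMod A B U C₁ C₂) := by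
  obtain ⟨e⟩ := exists_finsupp_equiv_pMod (A := A) (B := B) (U := U) K C₁ C₂
  have h := isRetract_pMod (U := U) (h₁.trans (.finsupp_index i C₁))
    (h₂.trans (.finsupp_index j C₂))
  exact h.trans (.of_equiv e.symm)

theorem isBigAdd_pMod (h₁ : IsBigAdd A C₁ M₁) (h₂ : IsBigAdd B C₂ M₂) :
    IsBigAdd (TriRing A B U) (pMod A B U C₁ C₂) (pMod A B U M₁ M₂) := by
  obtain ⟨I, h₁⟩ := isBigAdd_iff.1 h₁
  obtain ⟨J, h₂⟩ := isBigAdd_iff.1 h₂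
  exact isBigAdd_iff.2 ⟨I ⊕ J, isRetract_pMod_finsupp .inl .inr h₁ h₂⟩

theorem isSmallAdd_pMod (h₁ : IsSmallAdd A C₁ M₁) (h₂ : IsSmallAdd B C₂ M₂) :
    IsSmallAdd (TriRing A B U) (pMod A B U C₁ C₂) (pMod A B U M₁ M₂) := by
  obtain ⟨m, h₁⟩ := isSmallAdd_iff.1 h₁
  obtain ⟨n, h₂⟩ := isSmallAdd_iff.1 h₂
  exact isSmallAdd_iff.2 ⟨m + n, isRetract_pMod_finsupp
    ((Equiv.ulift.toEmbedding.trans (Fin.castAddEmb n)).trans Equiv.ulift.symm.toEmbedding)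
    ((Equiv.ulift.toEmbedding.trans (Fin.natAddEmb m)).trans Equiv.ulift.symm.toEmbedding) h₁ h₂⟩

theorem IsBigAdd.exists_retract_pMod (h : IsBigAdd (TriRing A B U) (pMod A B U C₁ C₂) N) :
    ∃ I : Type u, IsRetract (TriRing A B U) N (pMod A B U (I →₀ C₁) (I →₀ C₂)) := by
  obtain ⟨I, h⟩ := isBigAdd_iff.1 h
  obtain ⟨e⟩ := exists_finsupp_equiv_pMod (A := A) (B := B) (U := U) I C₁ C₂
  exact ⟨I, h.trans (.of_equiv e)⟩

theorem IsSmallAdd.exists_retract_pMod (h : IsSmallAdd (TriRing A B U) (pMod A B U C₁ C₂) N) :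
    ∃ n : ℕ, IsRetract (TriRing A B U) N
      (pMod A B U (ULift.{u} (Fin n) →₀ C₁) (ULift.{u} (Fin n) →₀ C₂)) := by
  obtain ⟨I, h⟩ := isSmallAdd_iff.1 h
  obtain ⟨e⟩ := exists_finsupp_equiv_pMod (A := A) (B := B) (U := U) (ULift.{u} (Fin I)) C₁ C₂
  exact ⟨I, h.trans (.of_equiv e)⟩

theorem IsBigAdd.fst (h : IsBigAdd (TriRing A B U) (pMod A B U C₁ C₂) N) :
    IsBigAdd A C₁ (Fst A B U N) := by
  obtain ⟨I, h⟩ := h.exists_retract_pMod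
  exact isBigAdd_iff.2 ⟨I, h.fst_of_pMod⟩

theorem IsBigAdd.bar (h : IsBigAdd (TriRing A B U) (pMod A B U C₁ C₂) N) :
    IsBigAdd B C₂ (Bar A B U N) := by
  obtain ⟨I, h⟩ := h.exists_retract_pMod
  exact isBigAdd_iff.2 ⟨I, h.bar_of_pMod⟩

theorem IsSmallAdd.fst (h : IsSmallAdd (TriRing A B U) (pMod A B U C₁ C₂) N) :
    IsSmallAdd A C₁ (Fst A B U N) := by
  obtain ⟨I, h⟩ := h.exists_retract_pMod
  exact isSmallAdd_iff.2 ⟨I, h.fst_of_pMod⟩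

theorem IsSmallAdd.bar (h : IsSmallAdd (TriRing A B U) (pMod A B U C₁ C₂) N) :
    IsSmallAdd B C₂ (Bar A B U N) := by
  obtain ⟨I, h⟩ := h.exists_retract_pMod
  exact isSmallAdd_iff.2 ⟨I, h.bar_of_pMod⟩

theorem IsBigAdd.phi_split (h : IsBigAdd (TriRing A B U) (pMod A B U C₁ C₂) N) :
    ∃ ρ, ρ ∘ₗ phi A B U N = LinearMap.id := by
  obtain ⟨I, h⟩ := h.exists_retract_pMod
  exact h.phi_split_of_pMod

theorem isRetract_of_fst_pMod : IsRetract A M₁ (Fst A B U (pMod A B U M₁ M₂)) :=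
  ⟨fstHom LinearMap.id, homFst LinearMap.id, rfl⟩

theorem isRetract_of_bar_pMod : IsRetract B M₂ (Bar A B U (pMod A B U M₁ M₂)) :=
  ⟨toBar ∘ₗ sndHom LinearMap.id ∘ₗ LinearMap.inr B _ _,
    barLift (LinearMap.snd B _ _ ∘ₗ homSnd LinearMap.id)
      (LinearMap.ext fun y => by simp [homSnd_phi]), rfl⟩

theorem finite_fst [Module.Finite (TriRing A B U) N] : Module.Finite A (Fst A B U N) :=
  .of_surjective (toFst (A := A) (B := B) (U := U) (N := N)) fun x => ⟨x, toFst_coe x⟩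

/-- Multiplication by `e₂` alone is not semilinear over `T → B`; the defect comes from `U` and lies
in the image of `phi`, so it disappears in the cokernel. -/
theorem finite_bar [Module.Finite (TriRing A B U) N] : Module.Finite B (Bar A B U N) := by
  let f : N →ₛₗ[TriRing.projB A B U] Bar A B U N :=
    { toFun := fun x => toBar (toSnd x)
      map_add' := fun x y => by rw [map_add, map_add]
      map_smul' := fun t x => by
        rw [toSnd_smul, map_add, toBar_phi, zero_add, map_smul]; rfl }
  refine .of_surjective f fun x => ?_
  obtain ⟨x, rfl⟩ := toBar_surjective x
  exact ⟨x, congrArg toBar (toSnd_coe x)⟩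

theorem finite_of_isRetract {R X Y : Type*} [Ring R] [AddCommGroup X] [Module R X]
    [AddCommGroup Y] [Module R Y] [Module.Finite R Y] (h : IsRetract R X Y) :
    Module.Finite R X := by
  obtain ⟨i, r, h⟩ := h
  exact .of_surjective r fun x => ⟨i x, LinearMap.congr_fun h x⟩

theorem finite_pMod [Module.Finite A M₁] [Module.Finite B M₂] :
    Module.Finite (TriRing A B U) (pMod A B U M₁ M₂) := by
  obtain ⟨s, hs⟩ := Module.Finite.fg_top (R := A) (M := M₁)
  obtain ⟨t, ht⟩ := Module.Finite.fg_top (R := B) (M := M₂)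
  classical
  let f : M₁ → pMod A B U M₁ M₂ := fun x => ⟨x, 0⟩
  let g : M₂ → pMod A B U M₁ M₂ := fun x => ⟨0, (0, x)⟩
  let W := Submodule.span (TriRing A B U) (f '' s ∪ g '' t)
  have hW₁ : ∀ x, f x ∈ W := fun x => by
    have hx : x ∈ Submodule.span A (s : Set M₁) := hs ▸ Submodule.mem_top
    induction hx using Submodule.span_induction with
    | mem x hx => exact Submodule.subset_span (.inl ⟨x, hx, rfl⟩)
    | zero => exact W.zero_mem
    | add x y _ _ hx hy =>
      rw [show f (x + y) = f x + f y by ext <;> simp [f]]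
      exact W.add_mem hx hy
    | smul a x _ hx =>
      rw [show f (a • x) = (⟨a, 0, 0⟩ : TriRing A B U) • f x by ext <;> simp [f, zero_btmul]]
      exact W.smul_mem _ hx
  have hW₂ : ∀ x, g x ∈ W := fun x => by
    have hx : x ∈ Submodule.span B (t : Set M₂) := ht ▸ Submodule.mem_top
    induction hx using Submodule.span_induction with
    | mem x hx => exact Submodule.subset_span (.inr ⟨x, hx, rfl⟩)
    | zero => exact W.zero_mem
    | add x y _ _ hx hy =>
      rw [show g (x + y) = g x + g y by ext <;> simp [g]]
      exact W.add_mem hx hy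
    | smul b x _ hx =>
      rw [show g (b • x) = (⟨0, 0, b⟩ : TriRing A B U) • g x by ext <;> simp [g, zero_btmul]]
      exact W.smul_mem _ hx
  -- A map out of `p(M₁, M₂)` that kills `M₁` and `M₂` is zero, so no generators of `U ⊗ M₁` over
  -- `B` are required.
  have h0 : W.mkQ = 0 := pMod_hom_ext
    (fun x => (Submodule.Quotient.mk_eq_zero W).2 (hW₁ x))
    (fun x => (Submodule.Quotient.mk_eq_zero W).2 (hW₂ x))
  have hW : W = ⊤ := by rw [← W.ker_mkQ, h0, LinearMap.ker_zero]
  exact ⟨Submodule.fg_def.2 ⟨_, (s.finite_toSet.image f).union (t.finite_toSet.image g), hW⟩⟩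

end AddP

/-! ### From sequences over `A` and `B` to sequences over `T`. -/

section PSequence

variable {A B U C₁ C₂ : Type u} [Ring A] [Ring B] [AddCommGroup U] [Module B U] [Module Aᵐᵒᵖ U]
  [SMulCommClass B Aᵐᵒᵖ U] [AddCommGroup C₁] [Module A C₁] [AddCommGroup C₂] [Module B C₂]
  {M₁ M₂ : Type u} [AddCommGroup M₁] [Module A M₁] [AddCommGroup M₂] [Module B M₂]

variable (U) in
/-- The sequence `p(S₁, S₂)`. -/
def pSeq (S₁ : ModSeq A) (S₂ : ModSeq B) : ModSeq (TriRing A B U) where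
  X n := ModuleCat.of _ (pMod A B U (S₁.X n) (S₂.X n))
  d n := pMap U (S₁.d n) (S₂.d n)

theorem pMap_exact {M N L : ModuleCat.{u} A} {M' N' L' : ModuleCat.{u} B}
    {f : M →ₗ[A] N} {g : N →ₗ[A] L} {f' : M' →ₗ[B] N'} {g' : N' →ₗ[B] L'}
    (h : Function.Exact f g) (hU : Function.Exact (bmap B U f) (bmap B U g))
    (h' : Function.Exact f' g') : Function.Exact (pMap U f f') (pMap U g g') := by
  rintro ⟨x, y, z⟩
  constructor
  · intro hx
    obtain ⟨x, rfl⟩ := (h x).1 (congrArg TriMod.fst hx)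
    obtain ⟨y, rfl⟩ := (hU y).1 (congrArg (fun t => t.snd.1) hx)
    obtain ⟨z, rfl⟩ := (h' z).1 (congrArg (fun t => t.snd.2) hx)
    exact ⟨⟨x, (y, z)⟩, rfl⟩
  · rintro ⟨⟨x', y', z'⟩, hx⟩
    rw [← hx]
    refine TriMod.ext ?_ (Prod.ext ?_ ?_)
    · exact h.apply_apply_eq_zero x'
    · exact hU.apply_apply_eq_zero y'
    · exact h'.apply_apply_eq_zero z'

theorem pSeq_isExact {S₁ : ModSeq A} {S₂ : ModSeq B} (h₁ : S₁.IsExact) (hU : S₁.TensorExact B U)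
    (h₂ : S₂.IsExact) : (pSeq U S₁ S₂).IsExact :=
  fun n => pMap_exact (h₁ n) (hU n) (h₂ n)

/-- By adjunction a cocycle is a pair of cocycles with values in `Fst F` and `Snd F`; the two are
extended separately. -/
theorem pSeq_homExact {S₁ : ModSeq A} {S₂ : ModSeq B} (h : (pSeq U S₁ S₂).IsExact)
    {F : Type u} [AddCommGroup F] [Module (TriRing A B U) F]
    (h₁ : S₁.HomExact (Fst A B U F)) (h₂ : S₂.HomExact (Snd A B U F)) :
    (pSeq U S₁ S₂).HomExact F := by
  refine h.homExact fun n f hf => ?_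
  let f' : pMod A B U (S₁.X (n + 1)) (S₂.X (n + 1)) →ₗ[TriRing A B U] F := f
  have hf' : ∀ x, f' (pMap U (S₁.d n) (S₂.d n) x) = 0 := fun x => LinearMap.congr_fun hf x
  obtain ⟨g₁, hg₁⟩ := h₁.exists_lift n (fstHom f') (LinearMap.ext fun x => Subtype.ext 
    ((congrArg f' (pMap_fst _ _ x)).symm.trans (hf' ⟨x, 0⟩)))
  obtain ⟨g₂, hg₂⟩ := h₂.exists_lift n (sndHom f' ∘ₗ LinearMap.inr B _ _)
    (LinearMap.ext fun x => Subtype.ext 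
      ((congrArg f' (pMap_snd _ _ x)).symm.trans (hf' ⟨0, (0, x)⟩)))
  refine ⟨pLift g₁ g₂, ?_⟩
  have : pLift g₁ g₂ ∘ₗ pMap U (S₁.d (n + 1)) (S₂.d (n + 1)) = f' := by
    refine pMod_hom_ext (fun x => ?_) (fun x => ?_)
    · have h3 := congrArg Subtype.val (LinearMap.congr_fun hg₁ x)
      refine Eq.trans ?_ h3
      simp [pLift_apply, pMap_apply]
    · have h3 := congrArg Subtype.val (LinearMap.congr_fun hg₂ x)
      refine Eq.trans ?_ h3
      simp [pLift_apply, pMap_apply]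
  exact this

theorem ModSeq.HomExact.prod {R : Type u} [Ring R] {S : ModSeq R} (hS : S.IsExact) {F G : Type u}
    [AddCommGroup F] [Module R F] [AddCommGroup G] [Module R G] (hF : S.HomExact F)
    (hG : S.HomExact G) : S.HomExact (F × G) := by
  refine hS.homExact fun n f hf => ?_
  obtain ⟨g₁, h₁⟩ := hF.exists_lift n (LinearMap.fst R F G ∘ₗ f) (by
    rw [LinearMap.comp_assoc, hf, LinearMap.comp_zero])
  obtain ⟨g₂, h₂⟩ := hG.exists_lift n (LinearMap.snd R F G ∘ₗ f) (by
    rw [LinearMap.comp_assoc, hf, LinearMap.comp_zero])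
  refine ⟨g₁.prod g₂, LinearMap.ext fun x => Prod.ext ?_ ?_⟩
  · exact LinearMap.congr_fun h₁ x
  · exact LinearMap.congr_fun h₂ x

/-- If `q` is a cokernel of `f` and `i ∘ q = g` with `f`, `g` exact, then `i` is injective. -/
theorem injective_of_exact {R P₁ P₀ C M : Type*} [Ring R] [AddCommGroup P₁] [Module R P₁]
    [AddCommGroup P₀] [Module R P₀] [AddCommGroup C] [Module R C] [AddCommGroup M] [Module R M]
    {f : P₁ →ₗ[R] P₀} {g : P₀ →ₗ[R] C} (h : Function.Exact f g) {q : P₀ →ₗ[R] M}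
    {i : M →ₗ[R] C} (hq : Function.Surjective q) (hiq : i ∘ₗ q = g) (hqf : q ∘ₗ f = 0) :
    Function.Injective i := by
  refine (injective_iff_map_eq_zero i).2 fun m hm => ?_
  obtain ⟨x, rfl⟩ := hq m
  obtain ⟨y, rfl⟩ := (h x).1 ((LinearMap.congr_fun hiq x).symm.trans hm)
  exact LinearMap.congr_fun hqf y

theorem comp_eq_zero_of_injective {R P₁ P₀ C M : Type*} [Ring R] [AddCommGroup P₁] [Module R P₁]
    [AddCommGroup P₀] [Module R P₀] [AddCommGroup C] [Module R C] [AddCommGroup M] [Module R M]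
    {f : P₁ →ₗ[R] P₀} {g : P₀ →ₗ[R] C} (h : Function.Exact f g) {q : P₀ →ₗ[R] M}
    {i : M →ₗ[R] C} (hi : Function.Injective i) (hiq : i ∘ₗ q = g) : q ∘ₗ f = 0 := by
  refine LinearMap.ext fun x => hi ?_
  have := LinearMap.congr_fun hiq (f x)
  simp only [LinearMap.comp_apply] at this
  simp [this, h.apply_apply_eq_zero]

/-- If `U` is weakly compatible, `p` preserves relative Gorenstein projectivity. -/
theorem isGProjective_pMod (hU : IsWeaklyCompatible A B U C₁ C₂) (h₁ : IsGProjective A C₁ M₁)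
    (h₂ : IsGProjective B C₂ M₂) :
    IsGProjective (TriRing A B U) (pMod A B U C₁ C₂) (pMod A B U M₁ M₂) := by
  obtain ⟨S₁, ex₁, hom₁, sh₁, p₁, i₁, hp₁, hi₁, hip₁⟩ := isGProjective_iff.1 h₁
  obtain ⟨S₂, ex₂, hom₂, sh₂, p₂, i₂, hp₂, hi₂, hip₂⟩ := isGProjective_iff.1 h₂
  have ten := hU.1 S₁ ex₁ hom₁ sh₁
  have ex := pSeq_isExact ex₁ ten ex₂
  refine isGProjective_iff.2 ⟨pSeq U S₁ S₂, ex, fun F hF => ?_, ⟨fun n hn => ?_, fun n hn => ?_⟩,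
    pMap U p₁ p₂, pMap U i₁ i₂, ?_, ?_, ?_⟩
  · obtain ⟨I, hI⟩ := hF.exists_retract_pMod
    have big₁ : IsBigAdd A C₁ (I →₀ C₁) := isBigAdd_iff.2 ⟨I, .of_equiv (.refl _ _)⟩
    have big₂ : IsBigAdd B C₂ (I →₀ C₂) := isBigAdd_iff.2 ⟨I, .of_equiv (.refl _ _)⟩
    -- `Snd F` need not lie in `Add(C₂)`: it is a retract of `(U ⊗ C₁^(I)) × C₂^(I)`, and condition
    -- (b) covers the first factor.
    refine pSeq_homExact ex (hom₁ (ModuleCat.of A _) hF.fst) (.retract hI.snd_of_pMod ?_)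
    exact .prod ex₂ (hU.2 S₂ ex₂ hom₂ sh₂ (ModuleCat.of A _) big₁) (hom₂ (ModuleCat.of B _) big₂)
  · have := sh₁.1 n hn
    have := sh₂.1 n hn
    exact projective_pMod (A := A) (B := B) (U := U) (M₁ := S₁.X n) (M₂ := S₂.X n)
  · exact isBigAdd_pMod (sh₁.2 n hn) (sh₂.2 n hn)
  · rintro ⟨x, y, z⟩
    obtain ⟨x, rfl⟩ := hp₁ x
    obtain ⟨y, rfl⟩ := bmap_surjective hp₁ y
    obtain ⟨z, rfl⟩ := hp₂ z
    exact ⟨⟨x, (y, z)⟩, rfl⟩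
  -- Tensoring need not preserve the injectivity of `i₁`; here it follows from exactness of `U ⊗ S₁`
  -- at `P₀`.
  · have hten : Function.Injective (bmap B U i₁) := by
      refine injective_of_exact (ten (-2)) (bmap_surjective hp₁) ?_ ?_
      · rw [← bmap_comp, hip₁]
      · rw [← bmap_comp, comp_eq_zero_of_injective (ex₁ (-2)) hi₁ hip₁, bmap_zero]
    intro x y hxy
    refine TriMod.ext (hi₁ (congrArg TriMod.fst hxy)) (Prod.ext (hten ?_) (hi₂ ?_))
    · exact congrArg (fun t => t.snd.1) hxy
    · exact congrArg (fun t => t.snd.2) hxy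
  · have : pMap U i₁ i₂ ∘ₗ pMap U p₁ p₂ = pMap U (S₁.d (-2 + 1)) (S₂.d (-2 + 1)) := by
      rw [← hip₁, ← hip₂]
      refine LinearMap.ext fun x => ?_
      simp only [LinearMap.comp_apply, pMap_apply, bmap_comp]
    exact this

end PSequence

/-! ### From sequences over `T` to sequences of first components and cokernels. -/

section ComponentSequences

variable {A B U C₁ C₂ : Type u} [Ring A] [Ring B] [AddCommGroup U] [Module B U] [Module Aᵐᵒᵖ U]
  [SMulCommClass B Aᵐᵒᵖ U] [AddCommGroup C₁] [Module A C₁] [AddCommGroup C₂] [Module B C₂]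
  {M N : Type u} [AddCommGroup M] [Module (TriRing A B U) M] [AddCommGroup N]
  [Module (TriRing A B U) N]

theorem barMap_comp {L : Type u} [AddCommGroup L] [Module (TriRing A B U) L]
    (f : M →ₗ[TriRing A B U] N) (g : N →ₗ[TriRing A B U] L) :
    barMap (g ∘ₗ f) = barMap g ∘ₗ barMap f := bar_hom_ext fun _ => rfl

theorem barMap_zero : barMap (0 : M →ₗ[TriRing A B U] N) = 0 :=
  bar_hom_ext fun x => by
    rw [barMap_toBar, show sndMap (0 : M →ₗ[TriRing A B U] N) x = 0 from rfl, map_zero]; rfl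

/-- The sequence of first components. -/
def fstSeq (S : ModSeq (TriRing A B U)) : ModSeq A where
  X n := ModuleCat.of A (Fst A B U (S.X n))
  d n := fstMap (S.d n)

/-- The sequence of cokernels of the structure maps. -/
def barSeq (S : ModSeq (TriRing A B U)) : ModSeq B where
  X n := ModuleCat.of B (Bar A B U (S.X n))
  d n := barMap (S.d n)

/-- This is a piece of the long exact sequence of `U ⊗ Fst → Snd → Bar`: exactness of `Bar` at `N₁`
needs exactness of `U ⊗ Fst` one place further, at `N₂`, where injectivity of `phi` on `N₃` turns
the element found into a cycle. -/
theorem barMap_exact {N₀ N₁ N₂ N₃ : Type u} [AddCommGroup N₀] [Module (TriRing A B U) N₀]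
    [AddCommGroup N₁] [Module (TriRing A B U) N₁] [AddCommGroup N₂] [Module (TriRing A B U) N₂]
    [AddCommGroup N₃] [Module (TriRing A B U) N₃] {f : N₀ →ₗ[TriRing A B U] N₁}
    {g : N₁ →ₗ[TriRing A B U] N₂} {h : N₂ →ₗ[TriRing A B U] N₃} (hfg : Function.Exact f g)
    (hgh : h ∘ₗ g = 0) (hten : Function.Exact (bmap B U (fstMap g)) (bmap B U (fstMap h)))
    (hphi : Function.Injective (phi A B U N₃)) : Function.Exact (barMap f) (barMap g) := by
  intro x
  constructor
  · obtain ⟨x, rfl⟩ := toBar_surjective x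
    intro hx
    obtain ⟨y, hy⟩ := toBar_eq_zero_iff.1 hx
    have h1 : bmap B U (fstMap h) y = 0 := by
      refine hphi ?_
      rw [← sndMap_phi, hy, map_zero]
      exact Subtype.ext (LinearMap.congr_fun hgh (x : N₁))
    obtain ⟨y, rfl⟩ := (hten y).1 h1
    have h2 : sndMap g (x - phi A B U N₁ y) = 0 := by
      rw [map_sub, sndMap_phi, hy, sub_self]
    obtain ⟨z, hz⟩ := (sndMap_exact hfg _).1 h2
    refine ⟨toBar z, ?_⟩
    rw [barMap_toBar, hz, map_sub, toBar_phi, sub_zero]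
  · rintro ⟨y, rfl⟩
    rw [← LinearMap.comp_apply, ← barMap_comp, hfg.linearMap_comp_eq_zero, barMap_zero]
    rfl

theorem phi_split_of_hasShape {S : ModSeq (TriRing A B U)}
    (h : S.HasShape (pMod A B U C₁ C₂)) (n : ℤ) :
    ∃ ρ, ρ ∘ₗ phi A B U (S.X n) = LinearMap.id := by
  rcases lt_or_ge n 0 with hn | hn
  · have := h.1 n hn
    exact (exists_retract_of_projective (A := A) (B := B) (U := U) (N := S.X n)).phi_split_of_pMod
  · exact (h.2 n hn).phi_split

theorem phi_injective_of_hasShape {S : ModSeq (TriRing A B U)}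
    (h : S.HasShape (pMod A B U C₁ C₂)) (n : ℤ) : Function.Injective (phi A B U (S.X n)) := by
  obtain ⟨ρ, hρ⟩ := phi_split_of_hasShape h n
  exact Function.LeftInverse.injective fun y => LinearMap.congr_fun hρ y

theorem fstSeq_hasShape {S : ModSeq (TriRing A B U)} (h : S.HasShape (pMod A B U C₁ C₂)) :
    (fstSeq S).HasShape C₁ := by
  refine ⟨fun n hn => ?_, fun n hn => (h.2 n hn).fst⟩
  have := h.1 n hn
  obtain ⟨i, r, hri⟩ :=
    (exists_retract_of_projective (A := A) (B := B) (U := U) (N := S.X n)).fst_of_pMod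
  exact Module.Projective.of_split i r hri

theorem barSeq_hasShape {S : ModSeq (TriRing A B U)} (h : S.HasShape (pMod A B U C₁ C₂)) :
    (barSeq S).HasShape C₂ := by
  refine ⟨fun n hn => ?_, fun n hn => (h.2 n hn).bar⟩
  have := h.1 n hn
  obtain ⟨i, r, hri⟩ :=
    (exists_retract_of_projective (A := A) (B := B) (U := U) (N := S.X n)).bar_of_pMod
  exact Module.Projective.of_split i r hri

theorem fstSeq_isExact {S : ModSeq (TriRing A B U)} (h : S.IsExact) : (fstSeq S).IsExact :=
  fun n => fstMap_exact (h n)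

theorem barSeq_isExact {S : ModSeq (TriRing A B U)} (h : S.IsExact)
    (hS : S.HasShape (pMod A B U C₁ C₂)) (hten : (fstSeq S).TensorExact B U) :
    (barSeq S).IsExact :=
  fun n => barMap_exact (h n) (h.comp_eq_zero _) (hten (n + 1)) (phi_injective_of_hasShape hS _)

/-- The map `N → (M₁; M₂)_φ` with zero first component induced by a map out of the cokernel of
the structure map. -/
def ofBar {M₁ M₂ : Type u} [AddCommGroup M₁] [Module A M₁] [AddCommGroup M₂] [Module B M₂]
    (φ : BTensor A B U M₁ →ₗ[B] M₂) (f : Bar A B U N →ₗ[B] M₂) :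
    N →ₗ[TriRing A B U] TriMod φ :=
  homToTri 0 (f ∘ₗ toBar) (LinearMap.ext fun y => by
    simp only [LinearMap.comp_apply, toBar_phi, bmap_zero, LinearMap.zero_apply, map_zero])

theorem ofBar_apply {M₁ M₂ : Type u} [AddCommGroup M₁] [Module A M₁] [AddCommGroup M₂]
    [Module B M₂] (φ : BTensor A B U M₁ →ₗ[B] M₂) (f : Bar A B U N →ₗ[B] M₂) (x : N) :
    ofBar φ f x = ⟨0, f (toBar (toSnd x))⟩ := rfl

theorem ofBar_comp {M₁ M₂ : Type u} [AddCommGroup M₁] [Module A M₁] [AddCommGroup M₂]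
    [Module B M₂] (φ : BTensor A B U M₁ →ₗ[B] M₂) (f : Bar A B U N →ₗ[B] M₂)
    (g : M →ₗ[TriRing A B U] N) : ofBar φ f ∘ₗ g = ofBar φ (f ∘ₗ barMap g) := by
  refine LinearMap.ext fun x => ?_
  simp only [LinearMap.comp_apply, ofBar_apply, toSnd_map, barMap_toBar]

/-- `Hom_B(Bar N, F)` is `Hom_T(N, p(0, F))`, and `p(0, F)` lies in `Add(C)`. -/
theorem barSeq_homAddExact {S : ModSeq (TriRing A B U)}
    (hS : S.HomAddExact (pMod A B U C₁ C₂)) (hbar : (barSeq S).IsExact) :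
    (barSeq S).HomAddExact C₂ := by
  intro F hF
  have big : IsBigAdd (TriRing A B U) (pMod A B U C₁ C₂) (pMod A B U PUnit.{u + 1} F) :=
    isBigAdd_pMod (isBigAdd_of_subsingleton C₁ PUnit) hF
  refine hbar.homExact fun n f hf => ?_
  let f' : Bar A B U (S.X (n + 1)) →ₗ[B] F := f
  have hf' : f' ∘ₗ barMap (S.d n) = 0 := hf
  obtain ⟨g, hg⟩ := (hS (ModuleCat.of _ _) big).exists_lift n
    (ofBar (LinearMap.inl B (BTensor A B U PUnit.{u + 1}) F) (LinearMap.inr B _ _ ∘ₗ f')) (by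
      rw [ofBar_comp, LinearMap.comp_assoc, hf', LinearMap.comp_zero]
      rfl)
  let g' : S.X (n + 1 + 1) →ₗ[TriRing A B U] pMod A B U PUnit.{u + 1} F := g
  refine ⟨barLift (LinearMap.snd B _ _ ∘ₗ homSnd g') (LinearMap.ext fun y => by
    simp [homSnd_phi]), bar_hom_ext fun x => ?_⟩
  have := congrArg (fun t : pMod A B U PUnit.{u + 1} F => t.snd.2)
    (LinearMap.congr_fun hg (x : S.X (n + 1)))
  refine Eq.trans this ?_
  exact congrArg (fun t => f' (toBar t)) (toSnd_coe x)

/-- For each term `X` of `S`, restriction to first components maps `Hom_T(X, p(Y, 0))` onto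
`Hom_A(Fst X, Y)`, because `phi` splits, with kernel `Hom_B(Bar X, U ⊗ Y)`. The middle and kernel
complexes are exact, hence so is the quotient; the proof is this chase made explicit. -/
theorem fstSeq_homAddExact {S : ModSeq (TriRing A B U)} (hex : S.IsExact)
    (hS : S.HomAddExact (pMod A B U C₁ C₂)) (hshape : S.HasShape (pMod A B U C₁ C₂))
    (hbar : ∀ Y : ModuleCat.{u} A, IsBigAdd A C₁ Y → (barSeq S).HomExact (BTensor A B U Y)) :
    (fstSeq S).HomAddExact C₁ := by
  intro Y hY
  have big : IsBigAdd (TriRing A B U) (pMod A B U C₁ C₂) (pMod A B U Y PUnit.{u + 1}) :=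
    isBigAdd_pMod hY (isBigAdd_of_subsingleton C₂ PUnit)
  refine (fstSeq_isExact hex).homExact fun n f hf => ?_
  -- The error term lives one degree lower, so the index is shifted.
  obtain ⟨m, rfl⟩ : ∃ m, n = m + 1 := ⟨n - 1, by ring⟩
  let f' : Fst A B U (S.X (m + 1 + 1)) →ₗ[A] Y := f
  have hf' : f' ∘ₗ fstMap (S.d (m + 1)) = 0 := hf
  obtain ⟨ρ, hρ⟩ := phi_split_of_hasShape hshape (m + 1 + 1)
  let F : S.X (m + 1 + 1) →ₗ[TriRing A B U] pMod A B U Y PUnit.{u + 1} :=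
    homToTri f' (LinearMap.inl B _ _ ∘ₗ bmap B U f' ∘ₗ ρ) (by
      rw [LinearMap.comp_assoc, LinearMap.comp_assoc, hρ, LinearMap.comp_id])
  have hF : homFst (F ∘ₗ S.d (m + 1)) = 0 := LinearMap.ext fun x => by
    refine Eq.trans ?_ (LinearMap.congr_fun hf' x)
    exact congrArg f' (toFst_coe (fstMap (S.d (m + 1)) x))
  let k₀ : Bar A B U (S.X (m + 1)) →ₗ[B] BTensor A B U Y :=
    barLift (LinearMap.fst B _ _ ∘ₗ homSnd (F ∘ₗ S.d (m + 1))) (LinearMap.ext fun y => by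
      simp [homSnd_phi, hF, bmap_zero])
  -- `F` lifts `f'` but need not be a cocycle. Its coboundary has zero first component, hence
  -- factors through the cokernel as `k₀`.
  have hFk : F ∘ₗ S.d (m + 1) = ofBar _ (LinearMap.inl B _ _ ∘ₗ k₀) := by
    refine homToTri_ext ?_ (LinearMap.ext fun x => Prod.ext ?_ (Subsingleton.elim _ _))
    · rw [hF]; rfl
    · exact congrArg (fun t => k₀ (toBar t)) (toSnd_coe x).symm
  have hk₀ : k₀ ∘ₗ barMap (S.d m) = 0 := bar_hom_ext fun x => by
    have := LinearMap.congr_fun (hex.comp_eq_zero m) (x : S.X m)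
    change (F (S.d (m + 1) (S.d m x))).snd.1 = 0
    rw [show S.d (m + 1) (S.d m x) = 0 from this, map_zero]
    rfl
  obtain ⟨k, hk⟩ := (hbar Y hY).exists_lift m k₀ hk₀
  let k' : Bar A B U (S.X (m + 1 + 1)) →ₗ[B] BTensor A B U Y := k
  have hk' : k' ∘ₗ barMap (S.d (m + 1)) = k₀ := hk
  -- Subtracting the map induced by `k'` makes `F` a cocycle and leaves its first component `f'`
  -- unchanged.
  obtain ⟨G, hG⟩ := (hS (ModuleCat.of _ _) big).exists_lift (m + 1)
    (F + ofBar _ (LinearMap.inl B _ PUnit.{u + 1} ∘ₗ (-k'))) (by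
      change (F + ofBar _ _) ∘ₗ _ = 0
      rw [LinearMap.add_comp, ofBar_comp, hFk, LinearMap.comp_assoc, LinearMap.neg_comp, hk']
      refine LinearMap.ext fun x => ?_
      refine TriMod.ext (add_zero 0) (Prod.ext ?_ (Subsingleton.elim _ _))
      exact add_neg_cancel (k₀ (toBar (toSnd x))))
  let G' : S.X (m + 1 + 1 + 1) →ₗ[TriRing A B U] pMod A B U Y PUnit.{u + 1} := G
  refine ⟨homFst G', LinearMap.ext fun (x : Fst A B U (S.X (m + 1 + 1))) => ?_⟩
  have := congrArg (fun t : pMod A B U Y PUnit.{u + 1} => t.fst)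
    (LinearMap.congr_fun hG (x : S.X (m + 1 + 1)))
  refine Eq.trans this ?_
  change f' (toFst (x : S.X (m + 1 + 1))) + 0 = f' x
  rw [add_zero]
  exact congrArg f' (toFst_coe x)

/-- The components of a relative Gorenstein projective `T`-module, for `U` compatible. -/
theorem IsGProjective.components (hU : IsCompatible A B U C₁ C₂)
    (h : IsGProjective (TriRing A B U) (pMod A B U C₁ C₂) N) :
    IsGProjective A C₁ (Fst A B U N) ∧ IsGProjective B C₂ (Bar A B U N) ∧
      (IsBigAdd A C₁ (Fst A B U N) →
        Nonempty (N ≃ₗ[TriRing A B U] pMod A B U (Fst A B U N) (Bar A B U N))) := by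
  obtain ⟨S, ex, hom, sh, p, i, hp, hi, hip⟩ := isGProjective_iff.1 h
  have fex := fstSeq_isExact ex
  have fsh := fstSeq_hasShape sh
  -- Condition (a) is what applies here: Hom-exactness of the first components is obtained below
  -- only by way of `ten`.
  have ten := hU.1 _ fex fsh
  have bex := barSeq_isExact ex sh ten
  have bsh := barSeq_hasShape sh
  have bhom := barSeq_homAddExact hom bex
  have fhom := fstSeq_homAddExact ex hom sh (hU.2 _ bex bhom bsh)
  have hpd := comp_eq_zero_of_injective (ex (-2)) hi hip
  refine ⟨isGProjective_iff.2 ⟨fstSeq S, fex, fhom, fsh, fstMap p, fstMap i, fstMap_surjective hp,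
      fun x y hxy => Subtype.ext (hi (congrArg Subtype.val hxy)), ?_⟩,
    isGProjective_iff.2 ⟨barSeq S, bex, bhom, bsh, barMap p, barMap i, barMap_surjective hp,
      injective_of_exact (bex (-2)) (barMap_surjective hp) ?_ ?_, ?_⟩, fun big => ?_⟩
  · exact congrArg fstMap hip
  · exact (barMap_comp p i).symm.trans (congrArg barMap hip)
  · exact (barMap_comp _ p).symm.trans ((congrArg barMap hpd).trans barMap_zero)
  · exact (barMap_comp p i).symm.trans (congrArg barMap hip)
  · refine exists_equiv_pMod ?_
    -- The surjection `P₀ → N` is a cocycle on first components with values in `Add(C₁)`. Its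
    -- extension to `C⁰` retracts `fstMap i`, and together with the splitting of `phi` on `C⁰` it
    -- splits `phi` on `N`.
    obtain ⟨g, hg⟩ := (fhom (ModuleCat.of A _) big).exists_lift (-2) (fstMap p)
      (congrArg fstMap hpd)
    let g' : Fst A B U (S.X (-2 + 1 + 1)) →ₗ[A] Fst A B U N := g
    have hg' : g' ∘ₗ fstMap i = LinearMap.id := LinearMap.ext fun x => by
      obtain ⟨x, rfl⟩ := fstMap_surjective hp x
      refine Eq.trans ?_ (LinearMap.congr_fun hg x)
      exact congrArg g' (Subtype.ext (LinearMap.congr_fun hip (x : S.X (-2 + 1))))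
    obtain ⟨ρ, hρ⟩ := phi_split_of_hasShape sh (-2 + 1 + 1)
    refine ⟨bmap B U g' ∘ₗ ρ ∘ₗ sndMap i, LinearMap.ext fun y => ?_⟩
    have h1 := LinearMap.congr_fun hρ (bmap B U (fstMap i) y)
    simp only [LinearMap.comp_apply, LinearMap.id_apply] at h1
    simp only [LinearMap.comp_apply, sndMap_phi, h1]
    rw [← LinearMap.comp_apply, ← bmap_comp, hg', bmap_id]

end ComponentSequences

/-! ### The two directions of the proposition. -/

section Main

variable {A B U C₁ C₂ : Type u} [Ring A] [Ring B] [AddCommGroup U] [Module B U] [Module Aᵐᵒᵖ U]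
  [SMulCommClass B Aᵐᵒᵖ U] [AddCommGroup C₁] [Module A C₁] [AddCommGroup C₂] [Module B C₂]

theorem IsCompatible.isWeaklyCompatible (h : IsCompatible A B U C₁ C₂) :
    IsWeaklyCompatible A B U C₁ C₂ :=
  ⟨fun S hS _ hS' => h.1 S hS hS', h.2⟩

theorem isGProjective_punit {R C : Type u} [Ring R] [AddCommGroup C] [Module R C]
    (hC : SigmaSelfOrthogonal R C) : IsGProjective R C PUnit.{u + 1} :=
  hC.isGProjective (isBigAdd_of_subsingleton C PUnit)

theorem isCMFree_components (hC₁ : SigmaSelfOrthogonal A C₁) (hC₂ : SigmaSelfOrthogonal B C₂)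
    (hU : IsWeaklyCompatible A B U C₁ C₂) (h : IsCMFree (TriRing A B U) (pMod A B U C₁ C₂)) :
    IsCMFree A C₁ ∧ IsCMFree B C₂ := by
  refine ⟨fun M => ⟨fun ⟨hM, hfin⟩ => ?_, fun hM => ⟨hC₁.isGProjective hM.isBigAdd, ?_⟩⟩,
    fun M => ⟨fun ⟨hM, hfin⟩ => ?_, fun hM => ⟨hC₂.isGProjective hM.isBigAdd, ?_⟩⟩⟩
  · exact ((h (ModuleCat.of _ (pMod A B U M PUnit.{u + 1}))).1
      ⟨isGProjective_pMod hU hM (isGProjective_punit hC₂), finite_pMod⟩).fst.retract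
      isRetract_of_fst_pMod
  -- Neither `C₁` nor `C₂` is assumed finitely generated; finiteness is drawn from the hypothesis on
  -- `T` through a module in `add(C)` having `M` as a component.
  · have : Module.Finite (TriRing A B U) (pMod A B U M C₂) :=
      ((h (ModuleCat.of _ (pMod A B U M C₂))).2 (isSmallAdd_pMod hM isSmallAdd_self)).2
    have := finite_fst (A := A) (B := B) (U := U) (N := pMod A B U M C₂)
    exact finite_of_isRetract (isRetract_of_fst_pMod (A := A) (B := B) (U := U) (M₂ := C₂))
  · exact ((h (ModuleCat.of _ (pMod A B U PUnit.{u + 1} M))).1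
      ⟨isGProjective_pMod hU (isGProjective_punit hC₁) hM, finite_pMod⟩).bar.retract
      isRetract_of_bar_pMod
  · have : Module.Finite (TriRing A B U) (pMod A B U C₁ M) :=
      ((h (ModuleCat.of _ (pMod A B U C₁ M))).2 (isSmallAdd_pMod isSmallAdd_self hM)).2
    have := finite_bar (A := A) (B := B) (U := U) (N := pMod A B U C₁ M)
    exact finite_of_isRetract (isRetract_of_bar_pMod (A := A) (B := B) (U := U) (M₁ := C₁))

theorem isStronglyCMFree_components (hC₁ : SigmaSelfOrthogonal A C₁)
    (hC₂ : SigmaSelfOrthogonal B C₂) (hU : IsWeaklyCompatible A B U C₁ C₂)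
    (h : IsStronglyCMFree (TriRing A B U) (pMod A B U C₁ C₂)) :
    IsStronglyCMFree A C₁ ∧ IsStronglyCMFree B C₂ := by
  refine ⟨fun M => ⟨fun hM => ?_, hC₁.isGProjective⟩, fun M => ⟨fun hM => ?_, hC₂.isGProjective⟩⟩
  · exact ((h (ModuleCat.of _ (pMod A B U M PUnit.{u + 1}))).1
      (isGProjective_pMod hU hM (isGProjective_punit hC₂))).fst.retract
      isRetract_of_fst_pMod
  · exact ((h (ModuleCat.of _ (pMod A B U PUnit.{u + 1} M))).1
      (isGProjective_pMod hU (isGProjective_punit hC₁) hM)).bar.retract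
      isRetract_of_bar_pMod

theorem isCMFree_triRing (hU : IsCompatible A B U C₁ C₂) (hA : IsCMFree A C₁)
    (hB : IsCMFree B C₂) : IsCMFree (TriRing A B U) (pMod A B U C₁ C₂) := by
  intro M
  constructor
  · rintro ⟨hM, hfin⟩
    obtain ⟨h₁, h₂, h₃⟩ := hM.components hU
    have s₁ := (hA (ModuleCat.of A _)).1 ⟨h₁, finite_fst⟩
    have s₂ := (hB (ModuleCat.of B _)).1 ⟨h₂, finite_bar⟩
    -- Splitting `M` as `p(Fst M, Bar M)` requires `Fst M` in `Add(C₁)`, which the assumption on `A`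
    -- has just provided.
    obtain ⟨e⟩ := h₃ s₁.isBigAdd
    exact (isSmallAdd_pMod s₁ s₂).retract (.of_equiv e)
  · intro hM
    obtain ⟨h₁, hfin₁⟩ := (hA (ModuleCat.of A _)).2 hM.fst
    obtain ⟨h₂, hfin₂⟩ := (hB (ModuleCat.of B _)).2 hM.bar
    obtain ⟨e⟩ := exists_equiv_pMod hM.isBigAdd.phi_split
    have : Module.Finite (TriRing A B U) (pMod A B U (Fst A B U M) (Bar A B U M)) := finite_pMod
    exact ⟨(isGProjective_pMod hU.isWeaklyCompatible h₁ h₂).of_equiv e, .equiv e.symm⟩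

theorem isStronglyCMFree_triRing (hU : IsCompatible A B U C₁ C₂) (hA : IsStronglyCMFree A C₁)
    (hB : IsStronglyCMFree B C₂) :
    IsStronglyCMFree (TriRing A B U) (pMod A B U C₁ C₂) := by
  intro M
  constructor
  · intro hM
    obtain ⟨h₁, h₂, h₃⟩ := hM.components hU
    have s₁ := (hA (ModuleCat.of A _)).1 h₁
    have s₂ := (hB (ModuleCat.of B _)).1 h₂
    obtain ⟨e⟩ := h₃ s₁
    exact (isBigAdd_pMod s₁ s₂).retract (.of_equiv e)
  · intro hM
    have h₁ := (hA (ModuleCat.of A _)).2 hM.fst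
    have h₂ := (hB (ModuleCat.of B _)).2 hM.bar
    obtain ⟨e⟩ := exists_equiv_pMod hM.phi_split
    exact (isGProjective_pMod hU.isWeaklyCompatible h₁ h₂).of_equiv e

end Main

end RelGor

theorem mainTheorem8 {A B U C₁ C₂ : Type u} [Ring A] [Ring B] [AddCommGroup U]
    [Module B U] [Module Aᵐᵒᵖ U] [SMulCommClass B Aᵐᵒᵖ U]
    [AddCommGroup C₁] [Module A C₁] [AddCommGroup C₂] [Module B C₂]
    (hC₁ : RelGor.SigmaSelfOrthogonal A C₁) (hC₂ : RelGor.SigmaSelfOrthogonal B C₂)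
    (hU : RelGor.IsWeaklyCompatible A B U C₁ C₂) :
    ((RelGor.IsCMFree (RelGor.TriRing A B U) (RelGor.pMod A B U C₁ C₂) →
        RelGor.IsCMFree A C₁ ∧ RelGor.IsCMFree B C₂) ∧
      (RelGor.IsStronglyCMFree (RelGor.TriRing A B U) (RelGor.pMod A B U C₁ C₂) →
        RelGor.IsStronglyCMFree A C₁ ∧ RelGor.IsStronglyCMFree B C₂)) ∧
    (RelGor.IsCompatible A B U C₁ C₂ →
      (RelGor.IsCMFree (RelGor.TriRing A B U) (RelGor.pMod A B U C₁ C₂) ↔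
        RelGor.IsCMFree A C₁ ∧ RelGor.IsCMFree B C₂) ∧
      (RelGor.IsStronglyCMFree (RelGor.TriRing A B U) (RelGor.pMod A B U C₁ C₂) ↔
        RelGor.IsStronglyCMFree A C₁ ∧ RelGor.IsStronglyCMFree B C₂)) :=
  ⟨⟨RelGor.isCMFree_components hC₁ hC₂ hU, RelGor.isStronglyCMFree_components hC₁ hC₂ hU⟩,
    fun hU' =>
      ⟨⟨RelGor.isCMFree_components hC₁ hC₂ hU, fun h => RelGor.isCMFree_triRing hU' h.1 h.2⟩,
        ⟨RelGor.isStronglyCMFree_components hC₁ hC₂ hU,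
          fun h => RelGor.isStronglyCMFree_triRing hU' h.1 h.2⟩⟩⟩
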